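/- Consider the Hamiltonian $H(\lambda,\Lambda)=-\frac32\Lambda^2+V(\lambda)$ with $V(\lambda)=1-\cos\lambda-\frac1{\sqrt{2+2\cos\lambda}}$, defined for $\Lambda\in\mathbb R$ and $\lambda\in\mathbb R/2\pi\mathbb Z$, $\lambda\neq\pi$, and its equations of motion $$\dot\lambda=-3\Lambda,\qquad \dot\Lambda=-\sin\lambda\left(1-\frac1{(2+2\cos\lambda)^{3/2}}\right).$$ Let $\sigma(t)=(\lambda_h(t),\Lambda_h(t))$, $t\in\mathbb R$, be the real-analytic time parametrization of its homoclinic orbit to the saddle $(0,0)$ (that is, $\sigma$ is a solution with $\sigma(t)\to(0,0)$ as $t\to\pm\infty$) that satisfies $\sigma(0)=(\lambda_0,0)$ with $\lambda_0\in\left(\frac{2\pi}3,\pi\right)$. Let $a_\pm=-\frac12\pm\frac{\sqrt2}2$ and $$A=\int_0^{a_+}\frac1{1-x}\sqrt{\frac{x}{3(x+1)(a_+-x)(x-a_-)}}\,dx\approx 0.177744 .$$ Then there is $\beta\in\left(0,\frac\pi2\right)$ such that $\sigma$ extends analytically to the domain $$\Pi^{\mathrm{ext}}_{A,\beta}=\{t\in\mathbb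 C:\ |\operatorname{Im}t|<(\tan\beta)\operatorname{Re}t+A\}\ \cup\ \{t\in\mathbb C:\ |\operatorname{Im}t|<-(\tan\beta)\operatorname{Re}t+A\}.$$ Moreover: 1. $\sigma$ has exactly two singularities on $\partial\Pi^{\mathrm{ext}}_{A,\beta}$, namely $t=\pm iA$. Here a boundary point is a singularity if the extension from $\Pi^{\mathrm{ext}}_{A,\beta}$ has no analytic continuation to a neighbourhood of that point. 2. $\Lambda_h$ has exactly one zero in the closure of $\Pi^{\mathrm{ext}}_{A,\beta}$, namely $t=0$. Here a boundary point is a zero if $\Lambda_h$ tends to $0$ there from inside $\Pi^{\mathrm{ext}}_{A,\beta}$. -/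

import Mathlib

open Filter Topology

namespace Separatrix

/-- The Hamiltonian vector field of `H(l, L) = -(3/2) L² + V(l)`, where
`V(l) = 1 - cos l - (2 + 2 cos l)^(-1/2)`. A point is written `p = (l, L)`. -/
noncomputable def field (p : ℝ × ℝ) : ℝ × ℝ :=
  (-3 * p.2,
    -Real.sin p.1 * (1 - 1 / (2 + 2 * Real.cos p.1) ^ (3 / 2 : ℝ)))

/-- `σ = (λ_h, Λ_h)` is the time parametrization of the right-hand homoclinic connection of the
saddle `(0, 0)`, normalized by `Λ_h 0 = 0`. The angle is represented by its lift to the real line,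
and `cos λ ≠ -1` says that the orbit lies in the phase space, which omits the collision
`λ = π mod 2π`. -/
structure IsSeparatrix (σ : ℝ → ℝ × ℝ) : Prop where
  noCollision : ∀ t, Real.cos (σ t).1 ≠ -1
  isSolution : ∀ t, HasDerivAt σ (field (σ t)) t
  tendsto_atBot : Tendsto σ atBot (𝓝 (0, 0))
  tendsto_atTop : Tendsto σ atTop (𝓝 (0, 0))
  angle_zero_mem : (σ 0).1 ∈ Set.Ioo (2 / 3 * Real.pi) Real.pi
  momentum_zero : (σ 0).2 = 0

noncomputable def aPlus : ℝ := -1 / 2 + Real.sqrt 2 / 2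

noncomputable def aMinus : ℝ := -1 / 2 - Real.sqrt 2 / 2

/-- The height `A` of the strip, about `0.177744`. -/
noncomputable def height : ℝ :=
  ∫ x in (0 : ℝ)..aPlus,
    1 / (1 - x) * Real.sqrt (x / (3 * (x + 1) * (aPlus - x) * (x - aMinus)))

/-- The bow-tie domain. -/
noncomputable def bowTie (A β : ℝ) : Set ℂ :=
  {t | |t.im| < Real.tan β * t.re + A} ∪ {t | |t.im| < -Real.tan β * t.re + A}

/-- The function `f` on `D` has an analytic continuation to a neighbourhood of the point `z`
of the closure of `D`. -/
def ExtendsAt (f : ℂ → ℂ × ℂ) (D : Set ℂ) (z : ℂ) : Prop :=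
  ∃ g : ℂ → ℂ × ℂ, AnalyticAt ℂ g z ∧ ∀ᶠ t in 𝓝[D] z, g t = f t

/-- The singularities of `f`, given on `D`, on the boundary of `D`. -/
def boundarySingularities (f : ℂ → ℂ × ℂ) (D : Set ℂ) : Set ℂ :=
  {z | z ∈ frontier D ∧ ¬ ExtendsAt f D z}

/-- The zeros of `h`, given on `D`, in the closure of `D`. At boundary points the value of `h` is
its limit from inside `D`; if `h` is continuous at `z ∈ D`, the condition says `h z = 0`. -/
def closureZeros (h : ℂ → ℂ) (D : Set ℂ) : Set ℂ :=
  {z | z ∈ closure D ∧ Tendsto h (𝓝[D] z) (𝓝 0)}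

end Separatrix

/-! With `q = cos (λ/2)`, the energy level of the saddle reads `3/2 Λ² + 2q² + 1/(2q) = 5/2`, so
along the orbit time is an Abelian integral in `q`. Put `q = d/(d + 2cp)` with `d = chSq z = cosh²
z`. Then `z = 0` is the turning point, `z → ±∞` along the reals is the saddle `q = 1`, and `z =
±iπ/2` is the collision `q = 0`. In this variable the angle and the momentum are explicit (`angle`,
`momentum`), and `dt/dz = speed z` is a branch of `d / (rate √((d + cp)(d + cr)))`, holomorphic
while `d` avoids the segment `[-cr, -cp]`. What remains is to invert its primitive `time` over a bow
tie.

On `region` the real part of `speed` is positive. So `time` has no critical point there, and only `z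
= 0` has time zero. The decisive estimate is `exists_slope`: on the boundary of `region`, `|Im t| ≥
A + m |Re t|` for some `m > 0`. Two arcs matter. The first is the curve `Re d = 0`, which leaves
`iπ/2`, where `time` is `iA`; the square of the velocity of `time` along it is explicit and lies in
the open first quadrant, thanks to `cp + cr = cp * cr`. The second is the boundary of a cone, where
`rate * time z` is `z` plus a constant up to an error of five per cent. Together with growth at
infinity this makes `time` proper over the bow tie of slope `m`. A proper local homeomorphism over a
connected set with a one-point fibre is bijective there (`existsUnique_preimage_of_proper`), which
gives a holomorphic inverse `S`.

On the real line `(angle ∘ S, momentum ∘ S)` is real and has constant energy, which forces it to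
solve the equations of motion. It has the same initial point as `σ`, hence equals `σ`
(`eq_of_isSeparatrix`).

The final bow tie has slope `m/2`: apart from the corners `±iA`, its closure lies in the bow tie of
slope `m`, so every other boundary point is regular. At the corners `d → 0` and `Λ²` has a pole in
`d`, which excludes both a continuation and a zero. On `region` the momentum vanishes only at `z =
0`, that is, at `t = 0`. -/

namespace Separatrix

/-! ### The principal square root -/

/-- The principal branch of the square root (away from zero). -/
noncomputable def csqrt (z : ℂ) : ℂ := Complex.exp (Complex.log z / 2)

theorem csqrt_sq {z : ℂ} (hz : z ≠ 0) : csqrt z ^ 2 = z := by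
  rw [csqrt, ← Complex.exp_nat_mul]
  push_cast
  rw [mul_div_cancel₀ _ (two_ne_zero), Complex.exp_log hz]

theorem csqrt_ne_zero (z : ℂ) : csqrt z ≠ 0 := Complex.exp_ne_zero _

theorem csqrt_re_pos {z : ℂ} (hz : z ∈ Complex.slitPlane) : 0 < (csqrt z).re := by
  rw [csqrt, Complex.exp_re]
  have h1 := Complex.neg_pi_lt_arg z
  have h2 : z.arg < Real.pi :=
    lt_of_le_of_ne (Complex.arg_le_pi z) (Complex.mem_slitPlane_iff_arg.mp hz).1
  refine mul_pos (Real.exp_pos _) (Real.cos_pos_of_mem_Ioo ⟨?_, ?_⟩)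
  · have : (Complex.log z / 2).im = z.arg / 2 := by simp [Complex.log_im]
    rw [this]; linarith
  · have : (Complex.log z / 2).im = z.arg / 2 := by simp [Complex.log_im]
    rw [this]; linarith

theorem differentiableAt_csqrt {z : ℂ} (hz : z ∈ Complex.slitPlane) :
    DifferentiableAt ℂ csqrt z :=
  ((Complex.differentiableAt_log hz).div_const 2).cexp

theorem csqrt_conj {z : ℂ} (hz : z ∈ Complex.slitPlane) :
    csqrt ((starRingEnd ℂ) z) = (starRingEnd ℂ) (csqrt z) := by
  rw [csqrt, Complex.log_conj _ (Complex.mem_slitPlane_iff_arg.mp hz).1, csqrt, ← Complex.exp_conj,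
    map_div₀, map_ofNat]

theorem csqrt_ofReal {x : ℝ} (hx : 0 < x) : csqrt (x : ℂ) = (Real.sqrt x : ℂ) := by
  rw [csqrt, ← Complex.ofReal_log hx.le, Real.sqrt_eq_rpow, Real.rpow_def_of_pos hx]
  push_cast
  ring_nf

/-- A number with positive real part is the principal root of its square. -/
theorem eq_csqrt {z s : ℂ} (hz : z ∈ Complex.slitPlane) (hs : 0 < s.re) (h : s ^ 2 = z) :
    s = csqrt z := by
  have h1 := csqrt_sq (Complex.slitPlane_ne_zero hz)
  rcases sq_eq_sq_iff_eq_or_eq_neg.mp (h.trans h1.symm) with h2 | h2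
  · exact h2
  · have := csqrt_re_pos hz
    rw [h2] at hs
    simp at hs
    linarith

/-- Square roots of numbers in the right half-plane lie in the sector `|arg| < π/4`. Products and
quotients of two elements of this sector return to the right half-plane, which is how the branches
of the roots are controlled. -/
theorem abs_im_lt_re_of_sq {s : ℂ} (hs : 0 < s.re) (h : 0 < (s ^ 2).re) : |s.im| < s.re := by
  rw [sq, Complex.mul_re] at h
  exact abs_lt_of_sq_lt_sq (by nlinarith) hs.le

theorem re_div_pos_of_abs_im_lt {s t : ℂ} (hs : |s.im| < s.re) (ht : |t.im| < t.re) :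
    0 < (s / t).re := by
  have h1 : 0 < t.re := lt_of_le_of_lt (abs_nonneg _) ht
  have h0 : 0 < s.re := lt_of_le_of_lt (abs_nonneg _) hs
  have h2 : 0 < Complex.normSq t := by
    rw [Complex.normSq_apply]; nlinarith [mul_self_nonneg t.im]
  rw [Complex.div_re, ← add_div]
  refine div_pos ?_ h2
  have h3 : |s.im * t.im| < s.re * t.re := by
    rw [abs_mul]
    exact mul_lt_mul'' hs ht (abs_nonneg _) (abs_nonneg _)
  linarith [neg_abs_le (s.im * t.im)]

theorem re_mul_pos_of_abs_im_lt {s t : ℂ} (hs : |s.im| < s.re) (ht : |t.im| < t.re) :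
    0 < (s * t).re := by
  have h1 : 0 < t.re := lt_of_le_of_lt (abs_nonneg _) ht
  have h0 : 0 < s.re := lt_of_le_of_lt (abs_nonneg _) hs
  rw [Complex.mul_re]
  have h3 : |s.im * t.im| < s.re * t.re := by
    rw [abs_mul]
    exact mul_lt_mul'' hs ht (abs_nonneg _) (abs_nonneg _)
  linarith [le_abs_self (s.im * t.im)]

/-! ### Primitives on star-shaped open sets -/

/-- The radial primitive of `f`. -/
noncomputable def radialIntegral (f : ℂ → ℂ) (z : ℂ) : ℂ := ∫ s in (0 : ℝ)..1, f (s * z) * z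

/-- Differentiating under the integral sign produces the integrand `s z f'(s z) + f(s z)`, which is
the `s`-derivative of `s f(s z)`. -/
theorem hasDerivAt_radialIntegral {f : ℂ → ℂ} {U : Set ℂ} (hU : IsOpen U)
    (hf : DifferentiableOn ℂ f U) (hs : ∀ z ∈ U, ∀ s ∈ Set.Icc (0 : ℝ) 1, (s : ℂ) * z ∈ U)
    {z : ℂ} (hz : z ∈ U) : HasDerivAt (radialIntegral f) (f z) z := by
  obtain ⟨ε, hε, hball⟩ := Metric.nhds_basis_closedBall.mem_iff.mp (hU.mem_nhds hz)
  set F' : ℂ → ℝ → ℂ := fun w s => deriv f (s * w) * s * w + f (s * w) with hF'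
  have hf' : DifferentiableOn ℂ (deriv f) U := hf.deriv hU
  have hmaps : ∀ w ∈ Metric.closedBall z ε, ∀ s ∈ Set.Icc (0 : ℝ) 1, (s : ℂ) * w ∈ U :=
    fun w hw s hs' => hs w (hball hw) s hs'
  have hcont' : ContinuousOn (fun x : ℂ × ℝ => F' x.1 x.2)
      (Metric.closedBall z ε ×ˢ Set.Icc (0 : ℝ) 1) := by
    have hm : Set.MapsTo (fun x : ℂ × ℝ => (x.2 : ℂ) * x.1)
        (Metric.closedBall z ε ×ˢ Set.Icc (0 : ℝ) 1) U := fun x hx => hmaps _ hx.1 _ hx.2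
    have hc : ContinuousOn (fun x : ℂ × ℝ => (x.2 : ℂ) * x.1)
        (Metric.closedBall z ε ×ˢ Set.Icc (0 : ℝ) 1) := by fun_prop
    have h1 := hf'.continuousOn.comp hc hm
    have h2 := hf.continuousOn.comp hc hm
    have h3 : Continuous (fun x : ℂ × ℝ => (x.2 : ℂ)) := by fun_prop
    exact ((h1.mul h3.continuousOn).mul continuous_fst.continuousOn).add h2
  obtain ⟨C, hC⟩ := ((isCompact_closedBall z ε).prod isCompact_Icc).exists_bound_of_continuousOn
    hcont'
  have hcontF : ∀ w ∈ Metric.closedBall z ε,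
      ContinuousOn (fun s : ℝ => f (s * w) * w) (Set.uIcc 0 1) := by
    intro w hw
    rw [Set.uIcc_of_le zero_le_one]
    refine ContinuousOn.mul (hf.continuousOn.comp (by fun_prop) fun s hs' => hmaps w hw s hs')
      continuousOn_const
  have hcontF' : ContinuousOn (F' z) (Set.uIcc 0 1) := by
    rw [Set.uIcc_of_le zero_le_one]
    have hc : Continuous (fun s : ℝ => (z, s)) := by fun_prop
    have hm : Set.MapsTo (fun s : ℝ => (z, s)) (Set.Icc (0 : ℝ) 1)
        (Metric.closedBall z ε ×ˢ Set.Icc (0 : ℝ) 1) :=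
      fun s hs' => Set.mk_mem_prod (Metric.mem_closedBall_self hε.le) hs'
    have h := hcont'.comp hc.continuousOn hm
    exact h
  have hint : ∫ s in (0 : ℝ)..1, F' z s = f z := by
    have h0 : ∀ s ∈ Set.uIcc (0 : ℝ) 1,
        HasDerivAt (fun s : ℝ => (s : ℂ) * f (s * z)) (F' z s) s := by
      intro s hs'
      rw [Set.uIcc_of_le zero_le_one] at hs'
      have hd : HasDerivAt f (deriv f (s * z)) (s * z) :=
        (hf.differentiableAt (hU.mem_nhds (hs z hz s hs'))).hasDerivAt
      have h1 : HasDerivAt (fun x : ℝ => (x : ℂ) * z) z s := by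
        simpa using (Complex.ofRealCLM.hasDerivAt (x := s)).mul_const z
      have h2 := HasDerivAt.comp (h₂ := f) s hd h1
      have h3 := (Complex.ofRealCLM.hasDerivAt (x := s)).mul h2
      refine h3.congr_deriv ?_
      simp [hF']
      ring
    rw [intervalIntegral.integral_eq_sub_of_hasDerivAt h0 hcontF'.intervalIntegrable]
    simp
  have key : HasDerivAt (radialIntegral f) (∫ s in (0 : ℝ)..1, F' z s) z := by
    refine (intervalIntegral.hasDerivAt_integral_of_dominated_loc_of_deriv_le
      (bound := fun _ => C) (Metric.closedBall_mem_nhds z hε) ?_ ?_ ?_ ?_ ?_ ?_).2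
    · filter_upwards [Metric.closedBall_mem_nhds z hε] with w hw
      exact (intervalIntegrable_iff.mp (hcontF w hw).intervalIntegrable).aestronglyMeasurable
    · exact (hcontF z (Metric.mem_closedBall_self hε.le)).intervalIntegrable
    · exact (intervalIntegrable_iff.mp hcontF'.intervalIntegrable).aestronglyMeasurable
    · refine Eventually.of_forall fun s hs' w hw => hC (w, s) ⟨hw, ?_⟩
      rw [Set.uIoc_of_le zero_le_one] at hs'
      exact Set.Ioc_subset_Icc_self hs'
    · exact intervalIntegrable_const
    · refine Eventually.of_forall fun s hs' w hw => ?_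
      rw [Set.uIoc_of_le zero_le_one] at hs'
      have hd : HasDerivAt f (deriv f (s * w)) (s * w) :=
        (hf.differentiableAt
          (hU.mem_nhds (hmaps w hw s (Set.Ioc_subset_Icc_self hs')))).hasDerivAt
      have h1 : HasDerivAt (fun x : ℂ => (s : ℂ) * x) s w := by
        simpa using (hasDerivAt_id w).const_mul (s : ℂ)
      have h3 := (HasDerivAt.comp (h₂ := f) w hd h1).mul (hasDerivAt_id w)
      refine h3.congr_deriv ?_
      simp [hF']
  rwa [hint] at key

/-! ### Proper local homeomorphisms with a one-point fibre -/

/-- Over `W` the image is open because `f` is a local homeomorphism, and relatively closed by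
properness, so connectedness gives surjectivity. The same argument applied to the values taken at
least twice gives injectivity, since `f z₀` is taken once. -/
theorem existsUnique_preimage_of_proper {f f' : ℂ → ℂ} {Ω W : Set ℂ} (hΩ : IsOpen Ω)
    (hf : ∀ z ∈ Ω, HasStrictDerivAt f (f' z) z) (hf' : ∀ z ∈ Ω, f' z ≠ 0)
    (hW : IsPreconnected W)
    (hproper : ∀ (u : ℕ → ℂ) (t : ℂ), (∀ n, u n ∈ Ω) → t ∈ W →
      Tendsto (fun n => f (u n)) atTop (𝓝 t) →
        ∃ z ∈ Ω, ∃ φ : ℕ → ℕ, StrictMono φ ∧ Tendsto (u ∘ φ) atTop (𝓝 z))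
    {z₀ : ℂ} (hz₀ : z₀ ∈ Ω) (hw₀ : f z₀ ∈ W) (huniq : ∀ z ∈ Ω, f z = f z₀ → z = z₀) :
    ∀ t ∈ W, ∃! z, z ∈ Ω ∧ f z = t := by
  have hmap : ∀ z ∈ Ω, map f (𝓝 z) = 𝓝 (f z) := fun z hz =>
    (hf z hz).map_nhds_eq (hf' z hz)
  have hlim : ∀ (u : ℕ → ℂ) (z t : ℂ), z ∈ Ω → Tendsto u atTop (𝓝 z) →
      Tendsto (fun n => f (u n)) atTop (𝓝 t) → f z = t := fun u z t hz h1 h2 =>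
    tendsto_nhds_unique ((hf z hz).hasDerivAt.continuousAt.tendsto.comp h1) h2
  have hsurj : W ⊆ f '' Ω := by
    refine hW.subset_of_closure_inter_subset ?_ ⟨f z₀, hw₀, z₀, hz₀, rfl⟩ ?_
    · rw [isOpen_iff_mem_nhds]
      rintro _ ⟨z, hz, rfl⟩
      rw [← hmap z hz]
      exact image_mem_map (hΩ.mem_nhds hz)
    · rintro t ⟨ht, htW⟩
      obtain ⟨x, hx, hxt⟩ := mem_closure_iff_seq_limit.mp ht
      choose u hu hux using hx
      have hut : Tendsto (fun n => f (u n)) atTop (𝓝 t) := by simpa only [hux] using hxt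
      obtain ⟨z, hz, φ, hφ, hlimz⟩ := hproper u t hu htW hut
      exact ⟨z, hz, hlim _ z t hz hlimz (hut.comp hφ.tendsto_atTop)⟩
  set V : Set ℂ := {t | ∃ a ∈ Ω, ∃ b ∈ Ω, a ≠ b ∧ f a = t ∧ f b = t} with hV
  have hVopen : IsOpen V := by
    rw [isOpen_iff_mem_nhds]
    rintro t ⟨a, ha, b, hb, hab, hat, hbt⟩
    obtain ⟨A, B, hA, hB, haA, hbB, hAB⟩ := t2_separation hab
    have h1 : f '' (A ∩ Ω) ∈ 𝓝 t := by
      rw [← hat, ← hmap a ha]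
      exact image_mem_map (inter_mem (hA.mem_nhds haA) (hΩ.mem_nhds ha))
    have h2 : f '' (B ∩ Ω) ∈ 𝓝 t := by
      rw [← hbt, ← hmap b hb]
      exact image_mem_map (inter_mem (hB.mem_nhds hbB) (hΩ.mem_nhds hb))
    filter_upwards [h1, h2]
    rintro s ⟨a', ha', rfl⟩ ⟨b', hb', hs⟩
    exact ⟨a', ha'.2, b', hb'.2, fun h => hAB.le_bot ⟨ha'.1, h ▸ hb'.1⟩, rfl, hs⟩
  have hVW : ¬ (W ∩ V).Nonempty := by
    intro hne
    have hsub := hW.subset_of_closure_inter_subset hVopen hne ?_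
    · obtain ⟨a, ha, b, hb, hab, ha', hb'⟩ := hsub hw₀
      exact hab ((huniq a ha ha').trans (huniq b hb hb').symm)
    · rintro t ⟨ht, htW⟩
      obtain ⟨x, hx, hxt⟩ := mem_closure_iff_seq_limit.mp ht
      choose u hu v hv huv hux hvx using hx
      have hut : Tendsto (fun n => f (u n)) atTop (𝓝 t) := by simpa only [hux] using hxt
      have hvt : Tendsto (fun n => f (v n)) atTop (𝓝 t) := by simpa only [hvx] using hxt
      obtain ⟨a, ha, φ, hφ, hlima⟩ := hproper u t hu htW hut
      obtain ⟨b, hb, ψ, hψ, hlimb⟩ := hproper (v ∘ φ) t (fun n => hv _) htW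
        (hvt.comp hφ.tendsto_atTop)
      have hlima' : Tendsto (u ∘ φ ∘ ψ) atTop (𝓝 a) := hlima.comp hψ.tendsto_atTop
      have hfa := hlim _ a t ha hlima (hut.comp hφ.tendsto_atTop)
      have hfb := hlim _ b t hb hlimb ((hvt.comp hφ.tendsto_atTop).comp hψ.tendsto_atTop)
      -- If the two limit preimages coincided, injectivity of `f` near the limit would identify
      -- distinct preimages of the same value.
      refine ⟨a, ha, b, hb, fun hab => ?_, hfa, hfb⟩
      subst hab
      have hinj := ((hf a ha).hasStrictFDerivAt_equiv (hf' a ha)).eventually_left_inverse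
      obtain ⟨n, hn1, hn2⟩ := ((hlima'.eventually hinj).and (hlimb.eventually hinj)).exists
      refine huv (φ (ψ n)) ?_
      simp only [Function.comp] at hn1 hn2
      rw [← hn1, ← hn2, hux, hvx]
  intro t ht
  obtain ⟨z, hz, hzt⟩ := hsurj ht
  refine ⟨z, ⟨hz, hzt⟩, fun y hy => ?_⟩
  by_contra hne
  exact hVW ⟨t, ht, y, hy.1, z, hz, hne, hy.2, hzt⟩

/-- Uniqueness of the preimage in `Ω` forces `S` to agree near `t` with the local inverse at `S t`.
-/
theorem hasDerivAt_of_unique_preimage {f f' S : ℂ → ℂ} {Ω W : Set ℂ} (hΩ : IsOpen Ω)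
    (hf : ∀ z ∈ Ω, HasStrictDerivAt f (f' z) z) (hf' : ∀ z ∈ Ω, f' z ≠ 0) (hW : IsOpen W)
    (hS : ∀ t ∈ W, S t ∈ Ω ∧ f (S t) = t) (huniq : ∀ t ∈ W, ∀ z ∈ Ω, f z = t → z = S t)
    {t : ℂ} (ht : t ∈ W) : HasDerivAt S (f' (S t))⁻¹ t := by
  obtain ⟨hz, hft⟩ := hS t ht
  have h1 := (hf _ hz).to_localInverse (hf' _ hz)
  rw [hft] at h1
  refine h1.hasDerivAt.congr_of_eventuallyEq ?_
  have hF := (hf _ hz).hasStrictFDerivAt_equiv (hf' _ hz)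
  have h2 : ∀ᶠ y in 𝓝 t, f ((hf _ hz).localInverse f _ _ (hf' _ hz) y) = y := by
    have := hF.eventually_right_inverse
    rwa [hft] at this
  have h4 : (hf _ hz).localInverse f _ _ (hf' _ hz) t = S t := by
    have := hF.localInverse_apply_image
    rwa [hft] at this
  have h3 : ∀ᶠ y in 𝓝 t, (hf _ hz).localInverse f _ _ (hf' _ hz) y ∈ Ω := by
    have := h1.hasDerivAt.continuousAt
    refine this.eventually_mem ?_
    rw [h4]
    exact hΩ.mem_nhds hz
  filter_upwards [h2, h3, hW.mem_nhds ht] with y hy1 hy2 hy3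
  exact (huniq y hy3 _ hy2 hy1).symm

/-! ### The uniformizing variable -/

/-- Chosen so that `q = d/(d + 2cp)` takes the turning value `aPlus = 1/(2cp + 1)` at `d = 1`;
moreover `q = -1` at `d = -cp`. -/
noncomputable def cp : ℝ := Real.sqrt 2 + 1 / 2

/-- At `d = -cr` the cosine `q = d/(d + 2cp)` equals `aMinus`, the other root of the radicand. -/
noncomputable def cr : ℝ := 1 + 4 * cp / 7

/-- The hyperbolicity rate of the saddle. -/
noncomputable def rate : ℝ := Real.sqrt (21 / 8)

theorem cp_quadratic : 4 * cp ^ 2 = 4 * cp + 7 := by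
  have h : Real.sqrt 2 ^ 2 = 2 := Real.sq_sqrt (by norm_num)
  rw [cp]; linear_combination 4 * h

theorem cp_gt : 1.9 < cp := by
  have : (1.4 : ℝ) < Real.sqrt 2 := Real.lt_sqrt_of_sq_lt (by norm_num)
  rw [cp]; linarith

theorem cp_lt : cp < 1.92 := by
  have : Real.sqrt 2 < 1.42 := by
    rw [Real.sqrt_lt' (by norm_num)]; norm_num
  rw [cp]; linarith

theorem cp_pos : 0 < cp := by linarith [cp_gt]

theorem cr_gt : 2.08 < cr := by rw [cr]; linarith [cp_gt]

theorem cr_lt : cr < 2.1 := by rw [cr]; linarith [cp_lt]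

theorem cr_pos : 0 < cr := by linarith [cr_gt]

/-- This relation removes the linear term in the cubic of `edge_derivative_bounds`, on which the
slope estimate rests. -/
theorem cp_add_cr : cp + cr = cp * cr := by
  rw [cr]; linear_combination (-1 / 7) * cp_quadratic

theorem rate_pos : 0 < rate := Real.sqrt_pos.mpr (by norm_num)

theorem rate_sq : rate ^ 2 = 21 / 8 := Real.sq_sqrt (by norm_num)

theorem rate_ne_zero : (rate : ℂ) ≠ 0 := Complex.ofReal_ne_zero.mpr rate_pos.ne'

theorem rate_sq_complex : (rate : ℂ) ^ 2 = 21 / 8 := by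
  rw [← Complex.ofReal_pow, rate_sq]; norm_num

/-- The square of the hyperbolic cosine. -/
noncomputable def chSq (z : ℂ) : ℂ := Complex.cosh z ^ 2

theorem chSq_eq (z : ℂ) : chSq z = (1 + Complex.cosh (2 * z)) / 2 := by
  rw [chSq, Complex.cosh_two_mul, Complex.sinh_sq]; ring

theorem chSq_neg (z : ℂ) : chSq (-z) = chSq z := by rw [chSq, chSq, Complex.cosh_neg]

theorem chSq_conj (z : ℂ) : chSq ((starRingEnd ℂ) z) = (starRingEnd ℂ) (chSq z) := by
  rw [chSq, chSq, Complex.cosh_conj, map_pow]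

theorem cosh_re (z : ℂ) : (Complex.cosh z).re = Real.cosh z.re * Real.cos z.im := by
  conv_lhs => rw [← Complex.re_add_im z]
  rw [Complex.cosh_add, Complex.cosh_mul_I, Complex.sinh_mul_I]
  simp [← Complex.ofReal_cosh, ← Complex.ofReal_sinh, ← Complex.ofReal_cos, ← Complex.ofReal_sin]

theorem cosh_im (z : ℂ) : (Complex.cosh z).im = Real.sinh z.re * Real.sin z.im := by
  conv_lhs => rw [← Complex.re_add_im z]
  rw [Complex.cosh_add, Complex.cosh_mul_I, Complex.sinh_mul_I]
  simp [← Complex.ofReal_cosh, ← Complex.ofReal_sinh, ← Complex.ofReal_cos, ← Complex.ofReal_sin]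

theorem chSq_re (z : ℂ) :
    (chSq z).re = (1 + Real.cosh (2 * z.re) * Real.cos (2 * z.im)) / 2 := by
  have h := cosh_re (2 * z)
  simp only [Complex.mul_re, Complex.mul_im, Complex.re_ofNat, Complex.im_ofNat, zero_mul,
    sub_zero, add_zero] at h
  rw [chSq_eq, Complex.div_ofNat_re, Complex.add_re, h]
  simp

theorem chSq_im (z : ℂ) : (chSq z).im = Real.sinh (2 * z.re) * Real.sin (2 * z.im) / 2 := by
  have h := cosh_im (2 * z)
  simp only [Complex.mul_re, Complex.mul_im, Complex.re_ofNat, Complex.im_ofNat, zero_mul,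
    sub_zero, add_zero] at h
  rw [chSq_eq, Complex.div_ofNat_im, Complex.add_im, h]
  simp

theorem norm_chSq (z : ℂ) : ‖chSq z‖ = (Real.cosh (2 * z.re) + Real.cos (2 * z.im)) / 2 := by
  rw [chSq, norm_pow, ← Complex.normSq_eq_norm_sq, Complex.normSq_apply, cosh_re, cosh_im,
    Real.cosh_two_mul, Real.cos_two_mul]
  have h1 := Real.sin_sq_add_cos_sq z.im
  have h2 := Real.cosh_sq z.re
  linear_combination (Real.sinh z.re) ^ 2 * h1 +
    (Real.cos z.im ^ 2 - 1 / 2) * h2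

theorem chSq_ofReal_mul_I (y : ℝ) : chSq (y * Complex.I) = ((Real.cos y ^ 2 : ℝ) : ℂ) := by
  rw [chSq, Complex.cosh_mul_I]; push_cast; rfl

theorem chSq_ofReal (x : ℝ) : chSq x = ((Real.cosh x ^ 2 : ℝ) : ℂ) := by
  rw [chSq]; push_cast; rfl

theorem hasDerivAt_chSq (z : ℂ) : HasDerivAt chSq (Complex.sinh (2 * z)) z := by
  have := (Complex.hasDerivAt_cosh z).pow 2
  refine this.congr_deriv ?_
  rw [Complex.sinh_two_mul]; push_cast; ring

/-- The derivative of the time along the separatrix with respect to the uniformizing variable. -/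
noncomputable def speed (z : ℂ) : ℂ :=
  chSq z / (rate * (chSq z + cr) * csqrt ((chSq z + cp) / (chSq z + cr)))

/-- The values of `chSq` that are not on the branch cut of `speed`. -/
def OffCut (d : ℂ) : Prop := ∀ k : ℝ, -cr ≤ k → k ≤ -cp → d ≠ k

theorem OffCut.add_cr_ne_zero {d : ℂ} (h : OffCut d) : d + cr ≠ 0 := by
  intro h0
  refine h (-cr) le_rfl (by linarith [cr_gt, cp_lt]) ?_
  push_cast
  linear_combination h0

theorem OffCut.add_cp_ne_zero {d : ℂ} (h : OffCut d) : d + cp ≠ 0 := by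
  intro h0
  refine h (-cp) (by linarith [cr_gt, cp_lt]) le_rfl ?_
  push_cast
  linear_combination h0

/-- The Möbius map `d ↦ (d + cp)/(d + cr)` carries only points of `[-cr, -cp]` to nonpositive reals.
Taking the root of the quotient, not of the product, thus keeps the cut bounded in `d`. -/
theorem OffCut.quotient_mem_slitPlane {d : ℂ} (h : OffCut d) :
    (d + cp) / (d + cr) ∈ Complex.slitPlane := by
  by_contra hc
  rw [Complex.mem_slitPlane_iff, not_or, not_lt, not_not] at hc
  obtain ⟨h1, h2⟩ := hc
  set k := ((d + cp) / (d + cr)).re with hk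
  have h3 : (d + cp) / (d + cr) = (k : ℂ) := by
    apply Complex.ext <;> simp [hk, h2]
  rw [div_eq_iff h.add_cr_ne_zero] at h3
  have hlt : cp < cr := by linarith [cr_gt, cp_lt]
  have hpos : 0 < 1 - k := by linarith
  refine h ((k * cr - cp) / (1 - k)) ?_ ?_ ?_
  · rw [le_div_iff₀ hpos]; nlinarith
  · rw [div_le_iff₀ hpos]; nlinarith
  · have : (1 - k : ℂ) ≠ 0 := by
      rw [← Complex.ofReal_one, ← Complex.ofReal_sub]
      exact Complex.ofReal_ne_zero.mpr hpos.ne'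
    push_cast
    rw [eq_div_iff this]
    linear_combination h3

theorem speed_sq {z : ℂ} (h : OffCut (chSq z)) :
    speed z ^ 2 = chSq z ^ 2 / (rate ^ 2 * (chSq z + cp) * (chSq z + cr)) := by
  have h1 := h.add_cr_ne_zero
  have h2 := h.add_cp_ne_zero
  rw [speed, div_pow, mul_pow, csqrt_sq (div_ne_zero h2 h1)]
  have := rate_ne_zero
  field_simp

theorem differentiableAt_speed {z : ℂ} (h : OffCut (chSq z)) : DifferentiableAt ℂ speed z := by
  have h1 := h.add_cr_ne_zero
  have hd : DifferentiableAt ℂ chSq z := (hasDerivAt_chSq z).differentiableAt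
  have h2 : DifferentiableAt ℂ (fun w => csqrt ((chSq w + cp) / (chSq w + cr))) z :=
    DifferentiableAt.comp (g := csqrt) z (differentiableAt_csqrt h.quotient_mem_slitPlane)
      ((hd.add_const _).div (hd.add_const _) h1)
  exact hd.div (((hd.add_const _).const_mul _).mul h2)
    (mul_ne_zero (mul_ne_zero rate_ne_zero h1) (csqrt_ne_zero _))

theorem speed_neg (z : ℂ) : speed (-z) = speed z := by rw [speed, speed, chSq_neg]

theorem speed_conj {z : ℂ} (h : OffCut (chSq z)) :
    speed ((starRingEnd ℂ) z) = (starRingEnd ℂ) (speed z) := by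
  rw [speed, speed, chSq_conj]
  simp only [map_div₀, map_mul, map_add, Complex.conj_ofReal,
    ← csqrt_conj h.quotient_mem_slitPlane]

/-- `speed` in terms of two separate roots. -/
theorem speed_eq {z : ℂ} (h0 : chSq z ≠ 0) (hp : 0 < (1 + cp / chSq z).re)
    (hr : 0 < (1 + cr / chSq z).re) :
    speed z = 1 / (rate * (csqrt (1 + cp / chSq z) * csqrt (1 + cr / chSq z))) ∧
      0 < (csqrt (1 + cp / chSq z) * csqrt (1 + cr / chSq z)).re := by
  set d := chSq z with hd
  set a := csqrt (1 + cp / d) with ha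
  set b := csqrt (1 + cr / d) with hb
  have hps : 1 + cp / d ∈ Complex.slitPlane := Or.inl hp
  have hrs : 1 + cr / d ∈ Complex.slitPlane := Or.inl hr
  have ha2 : a ^ 2 = 1 + cp / d := csqrt_sq (Complex.slitPlane_ne_zero hps)
  have hb2 : b ^ 2 = 1 + cr / d := csqrt_sq (Complex.slitPlane_ne_zero hrs)
  have ha' := abs_im_lt_re_of_sq (csqrt_re_pos hps) (by rw [← ha, ha2]; exact hp)
  have hb' := abs_im_lt_re_of_sq (csqrt_re_pos hrs) (by rw [← hb, hb2]; exact hr)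
  rw [← ha] at ha'
  rw [← hb] at hb'
  refine ⟨?_, re_mul_pos_of_abs_im_lt ha' hb'⟩
  have hane : a ≠ 0 := csqrt_ne_zero _
  have hbne : b ≠ 0 := csqrt_ne_zero _
  have h1 : d + cp = d * a ^ 2 := by rw [ha2]; field_simp
  have h2 : d + cr = d * b ^ 2 := by rw [hb2]; field_simp
  have hq : (a / b) ^ 2 = (d + cp) / (d + cr) := by
    rw [h1, h2]; field_simp
  -- Both roots have argument below `π/4` in modulus, so `a / b` is in the right half-plane and must
  -- be the principal root of the quotient inside `speed`.
  have hre := re_div_pos_of_abs_im_lt ha' hb'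
  have hslit : (d + cp) / (d + cr) ∈ Complex.slitPlane := by
    rw [← hq, Complex.mem_slitPlane_iff]
    by_contra hc
    rw [not_or, not_lt, not_not, sq, Complex.mul_re, Complex.mul_im] at hc
    obtain ⟨h3, h4⟩ := hc
    have h5 : (a / b).im = 0 := by
      have : (a / b).re * (a / b).im = 0 := by linarith
      exact (mul_eq_zero.mp this).resolve_left hre.ne'
    rw [h5] at h3
    nlinarith
  rw [speed, ← hd, ← eq_csqrt hslit hre hq, h2]
  have := rate_ne_zero
  field_simp

/-! ### Domains of the uniformizing variable -/

/-- A star-shaped domain on which `speed` is holomorphic. -/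
def bigDomain : Set ℂ :=
  -- The box makes `±iπ/2` interior points, and the cone is wider than that of `region`, so `time`
  -- is holomorphic on the whole boundary of `region`.
  {z | |z.im| < Real.pi / 2} ∪ {z | |z.re| < 1 ∧ |z.im| < 3} ∪
    {z | |z.im| < Real.pi / 6 * |z.re|}

/-- A domain that the time maps univalently over the bow tie. -/
def region : Set ℂ :=
  -- By `chSq_re` the second condition says that `chSq z` has positive real part.
  {z | |z.im| < Real.pi / 2 ∧ 0 < 1 + Real.cosh (2 * z.re) * Real.cos (2 * z.im)} ∪
    {z | |z.im| < Real.pi / 12 * |z.re|}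

theorem isOpen_bigDomain : IsOpen bigDomain := by
  refine (IsOpen.union ?_ ?_).union ?_
  · exact isOpen_lt (by fun_prop) (by fun_prop)
  · exact (isOpen_lt Complex.continuous_re.abs continuous_const).inter
      (isOpen_lt Complex.continuous_im.abs continuous_const)
  · exact isOpen_lt (by fun_prop) (by fun_prop)

theorem isOpen_region : IsOpen region := by
  have h : Continuous fun z : ℂ => 1 + Real.cosh (2 * z.re) * Real.cos (2 * z.im) :=
    continuous_const.add ((Real.continuous_cosh.comp (by fun_prop)).mul (by fun_prop))
  refine IsOpen.union ?_ ?_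
  · exact (isOpen_lt Complex.continuous_im.abs continuous_const).inter (isOpen_lt continuous_const h)
  · exact isOpen_lt (by fun_prop) (by fun_prop)

/-! ### Numerical bounds, avoidance of the cut, and positivity of the speed -/

theorem cosh_six_gt : 201 < Real.cosh 6 := by
  have h1 := Real.exp_one_gt_d9
  have h2 : Real.exp 6 = Real.exp 1 ^ 6 := by rw [← Real.exp_nat_mul]; norm_num
  have h3 : (2.718 : ℝ) ^ 6 ≤ Real.exp 1 ^ 6 := by gcongr; linarith
  rw [Real.cosh_eq, h2]
  have := Real.exp_pos (-6)
  norm_num at h3 ⊢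
  linarith

theorem cosh_two_lt : Real.cosh 2 < 4.3 := by
  have h1 := Real.exp_one_lt_d9
  have h2 : Real.exp 2 = Real.exp 1 ^ 2 := by rw [← Real.exp_nat_mul]; norm_num
  have h3 : Real.exp 1 ^ 2 ≤ (2.719 : ℝ) ^ 2 := by gcongr; linarith
  have h4 : Real.exp (-2) < 1 := by rw [Real.exp_lt_one_iff]; norm_num
  rw [Real.cosh_eq, h2]
  norm_num at h3 ⊢
  linarith

theorem cosh_two_mul_gt {x : ℝ} (hx : 3 ≤ |x|) : 201 < Real.cosh (2 * x) := by
  refine cosh_six_gt.trans_le ?_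
  rw [Real.cosh_le_cosh, abs_mul]
  norm_num
  linarith

theorem norm_chSq_gt {z : ℂ} (hz : 3 ≤ |z.re|) : 100 < ‖chSq z‖ := by
  rw [norm_chSq]
  linarith [cosh_two_mul_gt hz, Real.neg_one_le_cos (2 * z.im)]

/-- On the cut, `2 Im z` is an odd multiple of `π` and `cosh (2 Re z)` lies between 4.7 and 5.3. The
strip contradicts the first. The box contradicts the second because `cosh 2 < 4.3`; so does the rest
of the cone, where `|Re z| ≥ 3` and `cosh 6 > 201`. -/
theorem offCut_of_mem {z : ℂ} (hz : z ∈ bigDomain) : OffCut (chSq z) := by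
  intro k hk1 hk2 h
  have hre : (chSq z).re = k := by rw [h]; simp
  have him : (chSq z).im = 0 := by rw [h]; simp
  rw [chSq_re] at hre
  rw [chSq_im] at him
  have hp := cp_gt
  have hr := cr_lt
  have h3 : Real.cosh (2 * z.re) * Real.cos (2 * z.im) < -4.7 := by linarith
  have h3' : -5.3 < Real.cosh (2 * z.re) * Real.cos (2 * z.im) := by linarith
  have hsin : Real.sin (2 * z.im) = 0 := by
    have h4 : Real.sinh (2 * z.re) * Real.sin (2 * z.im) = 0 := by linarith
    rcases mul_eq_zero.mp h4 with h5 | h5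
    · rw [Real.sinh_eq_zero] at h5
      rw [h5, Real.cosh_zero] at h3
      linarith [Real.neg_one_le_cos (2 * z.im)]
    · exact h5
  have hcos : Real.cos (2 * z.im) = -1 := by
    have h4 := Real.sin_sq_add_cos_sq (2 * z.im)
    rw [hsin] at h4
    have h5 : (Real.cos (2 * z.im) - 1) * (Real.cos (2 * z.im) + 1) = 0 := by linarith
    rcases mul_eq_zero.mp h5 with h6 | h6
    · have : Real.cos (2 * z.im) = 1 := by linarith
      rw [this] at h3
      linarith [Real.cosh_pos (2 * z.re)]
    · linarith
  rw [hcos] at h3 h3'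
  have hstrip : ¬ |z.im| < Real.pi / 2 := by
    intro hy
    rw [abs_lt] at hy
    have h5 : 2 * z.im = 0 := by
      rwa [Real.sin_eq_zero_iff_of_lt_of_lt (by linarith) (by linarith)] at hsin
    rw [h5, Real.cos_zero] at hcos
    linarith
  rcases hz with (hz | hz) | hz
  · exact hstrip hz
  · have : Real.cosh (2 * z.re) ≤ Real.cosh 2 := by
      rw [Real.cosh_le_cosh, abs_mul]
      norm_num
      linarith [hz.1]
    linarith [cosh_two_lt]
  · have hz' : |z.im| < Real.pi / 6 * |z.re| := hz
    have hx : 3 ≤ |z.re| := by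
      by_contra hc
      exact hstrip (by nlinarith [Real.pi_pos])
    linarith [cosh_two_mul_gt hx]

theorem smul_mem_bigDomain {z : ℂ} (hz : z ∈ bigDomain) {s : ℝ} (hs : s ∈ Set.Icc (0 : ℝ) 1) :
    (s : ℂ) * z ∈ bigDomain := by
  have hre : ((s : ℂ) * z).re = s * z.re := by simp
  have him : ((s : ℂ) * z).im = s * z.im := by simp
  have h1 : |s * z.re| ≤ |z.re| := by
    rw [abs_mul, abs_of_nonneg hs.1]; exact mul_le_of_le_one_left (abs_nonneg _) hs.2
  have h2 : |s * z.im| ≤ |z.im| := by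
    rw [abs_mul, abs_of_nonneg hs.1]; exact mul_le_of_le_one_left (abs_nonneg _) hs.2
  rcases hs.1.eq_or_lt with rfl | hpos
  · left; left
    simp [Real.pi_pos]
  · rcases hz with (hz | hz) | hz
    · left; left
      simp only [Set.mem_ofPred_eq, him] at hz ⊢
      linarith
    · left; right
      simp only [Set.mem_ofPred_eq, him, hre] at hz ⊢
      exact ⟨by linarith [hz.1], by linarith [hz.2]⟩
    · right
      simp only [Set.mem_ofPred_eq, him, hre, abs_mul, abs_of_pos hpos] at hz ⊢
      nlinarith

theorem region_subset_bigDomain : region ⊆ bigDomain := by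
  rintro z (hz | hz)
  · exact Or.inl (Or.inl hz.1)
  · right
    simp only [Set.mem_ofPred_eq] at hz ⊢
    nlinarith [Real.pi_pos, abs_nonneg z.re]

/-- A point of the cone with small real part lies in the central part of `region`. -/
theorem cos_pos_of_le {z : ℂ} (h : |z.im| ≤ Real.pi / 12 * |z.re|) (hx : |z.re| < 3) :
    |z.im| < Real.pi / 4 ∧ 0 < Real.cos (2 * z.im) := by
  have h1 : |z.im| < Real.pi / 4 := by nlinarith [Real.pi_pos]
  refine ⟨h1, ?_⟩
  rw [abs_lt] at h1
  exact Real.cos_pos_of_mem_Ioo ⟨by linarith, by linarith⟩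

theorem mem_region_of_le {z : ℂ} (h : |z.im| ≤ Real.pi / 12 * |z.re|) (hx : |z.re| < 3) :
    z ∈ region := by
  obtain ⟨h1, h2⟩ := cos_pos_of_le h hx
  refine Or.inl ⟨by linarith [Real.pi_pos], ?_⟩
  linarith [mul_pos (Real.cosh_pos (2 * z.re)) h2]

theorem chSq_re_pos_or {z : ℂ} (hz : z ∈ region) :
    0 < (chSq z).re ∨ 3 ≤ |z.re| := by
  by_cases hx : 3 ≤ |z.re|
  · exact Or.inr hx
  · left
    rw [chSq_re]
    rcases hz with hz | hz
    · linarith [hz.2]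
    · have := (cos_pos_of_le (le_of_lt hz) (not_le.mp hx)).2
      linarith [mul_pos (Real.cosh_pos (2 * z.re)) this]

theorem chSq_ne_zero_of_mem {z : ℂ} (hz : z ∈ region) : chSq z ≠ 0 := by
  rcases chSq_re_pos_or hz with h | h
  · intro h0
    rw [h0] at h
    simp at h
  · have := norm_chSq_gt h
    intro h0
    rw [h0] at this
    simp at this
    linarith

/-- Either `chSq z` has positive real part, or `|Re z| ≥ 3` and `|chSq z| > 100`. This weak bound
still keeps `1 + k / chSq z` in the right half-plane for every constant `k` that occurs. -/
theorem inv_chSq_re_gt {z : ℂ} (hz : z ∈ region) : -(1 / 100) < ((chSq z)⁻¹).re := by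
  rcases chSq_re_pos_or hz with h | h
  · have h1 : 0 < ((chSq z)⁻¹).re := by
      rw [Complex.inv_re]
      exact div_pos h (Complex.normSq_pos.mpr (chSq_ne_zero_of_mem hz))
    linarith
  · have h1 := norm_chSq_gt h
    have h2 : ‖(chSq z)⁻¹‖ < 1 / 100 := by
      rw [norm_inv, ← one_div]
      exact one_div_lt_one_div_of_lt (by norm_num) h1
    have h3 := (abs_le.mp (Complex.abs_re_le_norm (chSq z)⁻¹)).1
    linarith

theorem one_add_div_re_pos {d : ℂ} (hd : -(1 / 100) < (d⁻¹).re) {k : ℝ} (hk0 : 0 < k)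
    (hk : k < 10) : 0 < (1 + k / d).re := by
  rw [div_eq_mul_inv, Complex.add_re, Complex.re_ofReal_mul, Complex.one_re]
  nlinarith

/-- `rate * speed` is the reciprocal of a product of two roots in the sector `|arg| < π/4`. The
positivity gives local invertibility of `time` and its monotonicity along real and vertical lines.
-/
theorem speed_re_pos {z : ℂ} (hz : z ∈ region) : 0 < (speed z).re := by
  have hd := inv_chSq_re_gt hz
  obtain ⟨h1, h2⟩ := speed_eq (chSq_ne_zero_of_mem hz)
    (one_add_div_re_pos hd cp_pos (by linarith [cp_lt]))
    (one_add_div_re_pos hd cr_pos (by linarith [cr_lt]))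
  rw [h1, one_div, ← Complex.ofReal_re rate] at *
  rw [Complex.inv_re, Complex.re_ofReal_mul]
  refine div_pos (mul_pos rate_pos h2) (Complex.normSq_pos.mpr ?_)
  exact mul_ne_zero rate_ne_zero (mul_ne_zero (csqrt_ne_zero _) (csqrt_ne_zero _))

/-! ### The time as a function of the uniformizing variable -/

noncomputable def time : ℂ → ℂ := radialIntegral speed

theorem hasDerivAt_time {z : ℂ} (hz : z ∈ bigDomain) : HasDerivAt time (speed z) z :=
  hasDerivAt_radialIntegral isOpen_bigDomain
    (fun _ hw => (differentiableAt_speed (offCut_of_mem hw)).differentiableWithinAt)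
    (fun _ hw _ hs => smul_mem_bigDomain hw hs) hz

theorem hasStrictDerivAt_time {z : ℂ} (hz : z ∈ bigDomain) :
    HasStrictDerivAt time (speed z) z := by
  have h : DifferentiableOn ℂ time bigDomain :=
    fun w hw => (hasDerivAt_time hw).differentiableAt.differentiableWithinAt
  have := (h.analyticAt (isOpen_bigDomain.mem_nhds hz)).hasStrictDerivAt
  rwa [(hasDerivAt_time hz).deriv] at this

theorem time_zero : time 0 = 0 := by simp [time, radialIntegral]

theorem time_neg (z : ℂ) : time (-z) = -time z := by
  simp only [time, radialIntegral]
  rw [← intervalIntegral.integral_neg]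
  congr 1
  ext s
  rw [mul_neg, mul_neg, speed_neg]

theorem time_conj {z : ℂ} (hz : z ∈ bigDomain) :
    time ((starRingEnd ℂ) z) = (starRingEnd ℂ) (time z) := by
  simp only [time, radialIntegral, intervalIntegral.integral_of_le zero_le_one]
  rw [← integral_conj]
  refine MeasureTheory.setIntegral_congr_fun measurableSet_Ioc fun s hs => ?_
  have h := smul_mem_bigDomain hz (Set.Ioc_subset_Icc_self hs)
  rw [map_mul, ← speed_conj (offCut_of_mem h), map_mul, Complex.conj_ofReal]

/-! ### The time on the imaginary axis -/

/-- The restriction of `speed` to the imaginary axis. -/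
noncomputable def axisSpeed (y : ℝ) : ℝ :=
  Real.cos y ^ 2 /
    (rate * (Real.cos y ^ 2 + cr) * Real.sqrt ((Real.cos y ^ 2 + cp) / (Real.cos y ^ 2 + cr)))

theorem speed_mul_I (y : ℝ) : speed (y * Complex.I) = axisSpeed y := by
  have h : 0 < (Real.cos y ^ 2 + cp) / (Real.cos y ^ 2 + cr) :=
    div_pos (by linarith [sq_nonneg (Real.cos y), cp_pos])
      (by linarith [sq_nonneg (Real.cos y), cr_pos])
  have h' : ((((Real.cos y ^ 2 : ℝ) : ℂ) + cp) / (((Real.cos y ^ 2 : ℝ) : ℂ) + cr)) =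
      (((Real.cos y ^ 2 + cp) / (Real.cos y ^ 2 + cr) : ℝ) : ℂ) := by
    simp only [Complex.ofReal_div, Complex.ofReal_add]
  rw [speed, chSq_ofReal_mul_I, h', csqrt_ofReal h, axisSpeed]
  simp only [Complex.ofReal_div, Complex.ofReal_add, Complex.ofReal_mul]

theorem time_mul_I (y : ℝ) :
    time (y * Complex.I) = (∫ s in (0 : ℝ)..y, axisSpeed s : ℝ) * Complex.I := by
  have h1 : ∀ s : ℝ, speed (s * (y * Complex.I)) * (y * Complex.I) =
      ((axisSpeed (y * s) * y : ℝ) : ℂ) * Complex.I := by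
    intro s
    have : (s : ℂ) * (y * Complex.I) = ((y * s : ℝ) : ℂ) * Complex.I := by push_cast; ring
    rw [this, speed_mul_I]; push_cast; ring
  simp only [time, radialIntegral, h1]
  rw [intervalIntegral.integral_mul_const, intervalIntegral.integral_ofReal,
    intervalIntegral.integral_mul_const, mul_comm _ y, intervalIntegral.mul_integral_comp_mul_left,
    mul_zero, mul_one]

theorem continuous_axisSpeed : Continuous axisSpeed := by
  unfold axisSpeed
  have h1 : ∀ y : ℝ, Real.cos y ^ 2 + cr ≠ 0 := fun y => by
    linarith [sq_nonneg (Real.cos y), cr_pos, (by positivity : 0 ≤ Real.cos y ^ 2)] |> ne_of_gt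
  have h2 : ∀ y : ℝ, 0 < Real.cos y ^ 2 + cp := fun y => by
    linarith [sq_nonneg (Real.cos y), cp_pos]
  have h3 : ∀ y : ℝ, 0 < Real.cos y ^ 2 + cr := fun y => by
    linarith [sq_nonneg (Real.cos y), cr_pos]
  refine Continuous.div (by fun_prop) ?_ fun y => ?_
  · refine Continuous.mul (by fun_prop) (Real.continuous_sqrt.comp ?_)
    exact Continuous.div (by fun_prop) (by fun_prop) h1
  · exact (mul_pos (mul_pos rate_pos (h3 y)) (Real.sqrt_pos.mpr (div_pos (h2 y) (h3 y)))).ne'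

theorem axisSpeed_nonneg (y : ℝ) : 0 ≤ axisSpeed y :=
  div_nonneg (sq_nonneg _) (mul_nonneg (mul_nonneg rate_pos.le
    (by linarith [sq_nonneg (Real.cos y), cr_pos])) (Real.sqrt_nonneg _))

theorem axisSpeed_pos {y : ℝ} (h : Real.cos y ≠ 0) : 0 < axisSpeed y := by
  have h2 : 0 < Real.cos y ^ 2 + cp := by linarith [sq_nonneg (Real.cos y), cp_pos]
  have h3 : 0 < Real.cos y ^ 2 + cr := by linarith [sq_nonneg (Real.cos y), cr_pos]
  exact div_pos (by positivity)
    (mul_pos (mul_pos rate_pos h3) (Real.sqrt_pos.mpr (div_pos h2 h3)))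

theorem axisSpeed_sq (y : ℝ) : axisSpeed y ^ 2 =
    8 / 21 * (Real.cos y ^ 2) ^ 2 / ((Real.cos y ^ 2 + cp) * (Real.cos y ^ 2 + cr)) := by
  have h2 : 0 < Real.cos y ^ 2 + cp := by linarith [sq_nonneg (Real.cos y), cp_pos]
  have h3 : 0 < Real.cos y ^ 2 + cr := by linarith [sq_nonneg (Real.cos y), cr_pos]
  rw [axisSpeed, div_pow, mul_pow, mul_pow, Real.sq_sqrt (div_pos h2 h3).le, rate_sq]
  field_simp

/-- Both constants exceed 1.9 and `d = cos² y ≤ 1`, so `(d + cp)(d + cr) ≥ (d + 1.9)² ≥ (2.9 d)²`.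
-/
theorem axisSpeed_le (y : ℝ) : axisSpeed y ≤ 1 / (2.9 * rate) := by
  set d := Real.cos y ^ 2 with hd
  have h0 : 0 ≤ d := sq_nonneg _
  have h1 : d ≤ 1 := Real.cos_sq_le_one y
  have h2 : 0 < d + cp := by linarith [cp_pos]
  have h3 : 0 < d + cr := by linarith [cr_pos]
  refine abs_le_of_sq_le_sq' ?_ ?_ |>.2
  · have hp := cp_gt
    have hr := cr_gt
    rw [axisSpeed_sq, div_pow, mul_pow, rate_sq, ← hd, div_le_div_iff₀ (by positivity) (by norm_num)]
    nlinarith [mul_nonneg h0 (by linarith : 0 ≤ 1 - d),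
      mul_pos (by linarith : 0 < cp - 1.9) (by linarith : 0 < cr - 1.9)]
  · have := rate_pos
    positivity

/-! ### The height of the strip -/

theorem aPlus_eq : aPlus = 1 / (2 * cp + 1) := by
  rw [eq_div_iff (by linarith [cp_pos])]
  have h : aPlus = cp / 2 - 3 / 4 := by rw [aPlus, cp]; ring
  rw [h]; linear_combination cp_quadratic / 4

theorem aMinus_eq : aMinus = -1 - 1 / (2 * cp + 1) := by
  rw [← aPlus_eq, aPlus, aMinus]; ring

/-- The cosine of half the angle in terms of the uniformizing variable on the imaginary axis. -/
noncomputable def axisCos (y : ℝ) : ℝ := Real.cos y ^ 2 / (Real.cos y ^ 2 + 2 * cp)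

theorem hasDerivAt_axisCos (y : ℝ) : HasDerivAt axisCos
    (-(4 * cp * (Real.cos y * Real.sin y) / (Real.cos y ^ 2 + 2 * cp) ^ 2)) y := by
  have h0 : Real.cos y ^ 2 + 2 * cp ≠ 0 := by
    have := sq_nonneg (Real.cos y)
    have := cp_pos
    positivity
  have h := (Real.hasDerivAt_cos y).pow 2
  refine (h.div (h.add_const (2 * cp)) h0).congr_deriv ?_
  simp only [Pi.pow_apply]
  field_simp
  push_cast
  ring

theorem image_axisCos : axisCos '' Set.Ioo 0 (Real.pi / 2) = Set.Ioo 0 aPlus := by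
  have hp := cp_pos
  ext x
  constructor
  · rintro ⟨y, hy, rfl⟩
    have hc : 0 < Real.cos y := Real.cos_pos_of_mem_Ioo ⟨by linarith [hy.1, Real.pi_pos], hy.2⟩
    have hs : 0 < Real.sin y := Real.sin_pos_of_pos_of_lt_pi hy.1 (by linarith [hy.2, Real.pi_pos])
    have h1 := Real.sin_sq_add_cos_sq y
    rw [aPlus_eq]
    refine ⟨div_pos (by positivity) (by positivity), ?_⟩
    rw [axisCos, div_lt_div_iff₀ (by positivity) (by positivity)]
    nlinarith [mul_pos hp (pow_pos hs 2)]
  · rintro ⟨h0, h1⟩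
    have hlt : x < 1 := by
      refine h1.trans ?_
      rw [aPlus_eq, div_lt_one (by positivity)]; linarith
    rw [aPlus_eq, lt_div_iff₀ (by positivity)] at h1
    set d := 2 * cp * x / (1 - x) with hd
    have hd0 : 0 < d := div_pos (by positivity) (by linarith)
    have hd1 : d < 1 := by rw [hd, div_lt_one (by linarith)]; linarith
    have hs : Real.sqrt d < 1 := by
      rw [Real.sqrt_lt' one_pos]; simpa using hd1
    have hs0 : 0 < Real.sqrt d := Real.sqrt_pos.mpr hd0
    refine ⟨Real.arccos (Real.sqrt d), ⟨Real.arccos_pos.mpr hs, ?_⟩, ?_⟩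
    · exact Real.arccos_lt_pi_div_two.mpr hs0
    · rw [axisCos, Real.cos_arccos (by linarith) hs.le, Real.sq_sqrt hd0.le,
        div_eq_iff (by positivity), hd]
      have : 1 - x ≠ 0 := by linarith
      field_simp
      ring

theorem injOn_axisCos : Set.InjOn axisCos (Set.Ioo 0 (Real.pi / 2)) := by
  have hp := cp_pos
  intro x hx y hy h
  have hcx : 0 < Real.cos x := Real.cos_pos_of_mem_Ioo ⟨by linarith [hx.1, Real.pi_pos], hx.2⟩
  have hcy : 0 < Real.cos y := Real.cos_pos_of_mem_Ioo ⟨by linarith [hy.1, Real.pi_pos], hy.2⟩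
  rw [axisCos, axisCos, div_eq_div_iff (by positivity) (by positivity)] at h
  have h1 : Real.cos x ^ 2 = Real.cos y ^ 2 := by
    have h2 : 2 * cp * Real.cos x ^ 2 = 2 * cp * Real.cos y ^ 2 := by linarith
    exact mul_left_cancel₀ (by positivity) h2
  have h2 : Real.cos x = Real.cos y := (sq_eq_sq₀ hcx.le hcy.le).mp h1
  exact Real.injOn_cos ⟨hx.1.le, by linarith [hx.2, Real.pi_pos]⟩
    ⟨hy.1.le, by linarith [hy.2, Real.pi_pos]⟩ h2

/-- Under `x = d/(d + 2cp)` the values `x = 0, -1, aPlus, aMinus` correspond to `d = 0, -cp, 1,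
-cr`. -/
theorem radicand_axisCos {d : ℝ} (h0 : 0 < d) (h1 : d < 1) :
    d / (d + 2 * cp) / (3 * (d / (d + 2 * cp) + 1) * (aPlus - d / (d + 2 * cp)) *
      (d / (d + 2 * cp) - aMinus)) =
    2 / 21 * d * (d + 2 * cp) ^ 2 / ((1 - d) * (d + cp) * (d + cr)) := by
  have hp := cp_pos
  have hr := cr_pos
  have hd : 1 - d ≠ 0 := by linarith
  have h2 : d + 2 * cp ≠ 0 := by positivity
  have h3 : 2 * cp + 1 ≠ 0 := by positivity
  have h4 : d + cp ≠ 0 := by positivity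
  have h5 : d + cr ≠ 0 := by positivity
  have e1 : d / (d + 2 * cp) + 1 = 2 * (d + cp) / (d + 2 * cp) := by field_simp; ring
  have e2 : aPlus - d / (d + 2 * cp) = 2 * cp * (1 - d) / ((2 * cp + 1) * (d + 2 * cp)) := by
    rw [aPlus_eq]; field_simp; ring
  have e3 : d / (d + 2 * cp) - aMinus =
      (4 * cp + 3) * (d + cr) / ((2 * cp + 1) * (d + 2 * cp)) := by
    rw [aMinus_eq, cr]
    field_simp
    linear_combination 3 * cp_quadratic
  have h6 : 4 * cp + 3 ≠ 0 := by positivity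
  rw [e1, e2, e3]
  field_simp
  linear_combination (-3) * cp_quadratic

/-- The substitution `x = axisCos y` identifies the height with the imaginary time from the turning
point to the collision. -/
theorem height_eq : height = ∫ y in (0 : ℝ)..(Real.pi / 2), axisSpeed y := by
  have hp := cp_pos
  have hpi := Real.pi_pos
  have ha : 0 ≤ aPlus := by rw [aPlus_eq]; positivity
  rw [height, intervalIntegral.integral_of_le ha, intervalIntegral.integral_of_le (by positivity),
    MeasureTheory.integral_Ioc_eq_integral_Ioo, MeasureTheory.integral_Ioc_eq_integral_Ioo,
    ← image_axisCos,
    MeasureTheory.integral_image_eq_integral_abs_deriv_smul measurableSet_Ioo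
      (fun y _ => (hasDerivAt_axisCos y).hasDerivWithinAt) injOn_axisCos]
  refine MeasureTheory.setIntegral_congr_fun measurableSet_Ioo fun y hy => ?_
  have hc : 0 < Real.cos y := Real.cos_pos_of_mem_Ioo ⟨by linarith [hy.1], hy.2⟩
  have hs : 0 < Real.sin y := Real.sin_pos_of_pos_of_lt_pi hy.1 (by linarith [hy.2])
  have hcs := Real.sin_sq_add_cos_sq y
  have hd1 : Real.cos y ^ 2 < 1 := by nlinarith
  have hd0 : 0 < Real.cos y ^ 2 := by positivity
  simp only [smul_eq_mul, axisCos]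
  rw [radicand_axisCos hd0 hd1, abs_neg, abs_of_pos (by positivity)]
  have hq : 1 - Real.cos y ^ 2 / (Real.cos y ^ 2 + 2 * cp) =
      2 * cp / (Real.cos y ^ 2 + 2 * cp) := by field_simp; ring
  rw [hq]
  have hr := cr_pos
  have hd2 : 0 < 1 - Real.cos y ^ 2 := by linarith
  refine (sq_eq_sq₀ (by positivity) (axisSpeed_nonneg y)).mp ?_
  rw [axisSpeed_sq, mul_pow, mul_pow, Real.sq_sqrt (by positivity)]
  have hs2 : 1 - Real.cos y ^ 2 = Real.sin y ^ 2 := by linarith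
  rw [hs2]
  field_simp
  ring

theorem integral_axisSpeed_lt {y : ℝ} (h0 : -(Real.pi / 2) ≤ y) (h1 : y < Real.pi / 2) :
    ∫ s in (0 : ℝ)..y, axisSpeed s < height := by
  have hint : ∀ a b, IntervalIntegrable axisSpeed MeasureTheory.volume a b :=
    fun a b => continuous_axisSpeed.intervalIntegrable a b
  rw [height_eq, ← sub_pos, intervalIntegral.integral_interval_sub_left (hint _ _) (hint _ _)]
  refine intervalIntegral.intervalIntegral_pos_of_pos_on (hint _ _) (fun s hs => ?_) h1
  exact axisSpeed_pos (Real.cos_pos_of_mem_Ioo ⟨by linarith [hs.1], hs.2⟩).ne'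

theorem height_pos : 0 < height := by
  have := integral_axisSpeed_lt (y := 0) (by linarith [Real.pi_pos]) (by linarith [Real.pi_pos])
  simpa using this

theorem rate_mul_height_le : rate * height ≤ Real.pi / 2 / 2.9 := by
  have hr := rate_pos
  have h : height ≤ ∫ y in (0 : ℝ)..(Real.pi / 2), 1 / (2.9 * rate) := by
    rw [height_eq]
    exact intervalIntegral.integral_mono_on (by linarith [Real.pi_pos])
      (continuous_axisSpeed.intervalIntegrable _ _) intervalIntegrable_const
      fun y _ => axisSpeed_le y
  rw [intervalIntegral.integral_const, smul_eq_mul] at h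
  calc rate * height ≤ rate * ((Real.pi / 2 - 0) * (1 / (2.9 * rate))) := by gcongr
    _ = Real.pi / 2 / 2.9 := by field_simp; ring

theorem time_pi_div_two : time ((Real.pi / 2 : ℝ) * Complex.I) = height * Complex.I := by
  rw [time_mul_I, height_eq]

/-! ### The time far from the origin -/

theorem speed_re_pos_of {z : ℂ} (h0 : chSq z ≠ 0) (hp : 0 < (1 + cp / chSq z).re)
    (hr : 0 < (1 + cr / chSq z).re) : 0 < (speed z).re := by
  obtain ⟨h1, h2⟩ := speed_eq h0 hp hr
  rw [h1, one_div, Complex.inv_re, Complex.re_ofReal_mul]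
  refine div_pos (mul_pos rate_pos h2) (Complex.normSq_pos.mpr ?_)
  exact mul_ne_zero rate_ne_zero (mul_ne_zero (csqrt_ne_zero _) (csqrt_ne_zero _))

/-- Write `rate * speed z = 1 / s`. Since `|d| > 100`, `s² - 1 = (cp + cr)/d + cp cr/d²` has norm at
most 0.041. As `Re s > 0`, `|s + 1| ≥ 1`, and `s` itself is that close to 1. -/
theorem norm_rate_mul_speed_sub_one_le {z : ℂ} (hz : 3 ≤ |z.re|) :
    ‖rate * speed z - 1‖ ≤ 1 / 20 := by
  have hD := norm_chSq_gt hz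
  set d := chSq z with hd
  have h0 : d ≠ 0 := by
    intro h; rw [h, norm_zero] at hD; linarith
  have hinv : ‖d⁻¹‖ < 1 / 100 := by
    rw [norm_inv, ← one_div]
    exact one_div_lt_one_div_of_lt (by norm_num) hD
  have hre : -(1 / 100) < (d⁻¹).re := by
    linarith [(abs_le.mp (Complex.abs_re_le_norm d⁻¹)).1]
  have hp := one_add_div_re_pos hre cp_pos (by linarith [cp_lt])
  have hr := one_add_div_re_pos hre cr_pos (by linarith [cr_lt])
  obtain ⟨h1, h2⟩ := speed_eq h0 hp hr
  rw [← hd] at h1 h2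
  set s := csqrt (1 + cp / d) * csqrt (1 + cr / d) with hs
  have hs0 : s ≠ 0 := mul_ne_zero (csqrt_ne_zero _) (csqrt_ne_zero _)
  have hps : (1 + cp / d) ≠ 0 := fun h => by rw [h] at hp; simp at hp
  have hrs : (1 + cr / d) ≠ 0 := fun h => by rw [h] at hr; simp at hr
  have hs2 : s ^ 2 - 1 = (cp + cr : ℝ) * d⁻¹ + (cp * cr : ℝ) * (d⁻¹ * d⁻¹) := by
    rw [hs, mul_pow, csqrt_sq hps, csqrt_sq hrs]
    push_cast
    field_simp
    ring
  have hk : cp + cr < 4.02 := by linarith [cp_lt, cr_lt]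
  have hk0 : 0 < cp + cr := by linarith [cp_pos, cr_pos]
  have hn : ‖s ^ 2 - 1‖ ≤ 0.041 := by
    rw [hs2]
    refine (norm_add_le _ _).trans ?_
    rw [norm_mul, norm_mul, norm_mul, ← cp_add_cr, Complex.norm_real, Real.norm_eq_abs,
      abs_of_pos hk0]
    have hi := norm_nonneg d⁻¹
    have e1 : ‖d⁻¹‖ * ‖d⁻¹‖ ≤ 1 / 100 * (1 / 100) := by gcongr
    nlinarith
  have hle : ‖s - 1‖ ≤ 0.041 := by
    have e1 : s ^ 2 - 1 = (s - 1) * (s + 1) := by ring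
    have e2 : 1 ≤ ‖s + 1‖ := by
      have := Complex.re_le_norm (s + 1)
      rw [Complex.add_re, Complex.one_re] at this
      linarith
    rw [e1, norm_mul] at hn
    nlinarith [norm_nonneg (s - 1)]
  have hge : 0.95 ≤ ‖s‖ := by
    have := norm_sub_norm_le (1 : ℂ) s
    rw [norm_one, norm_sub_rev] at this
    linarith
  have e3 : rate * speed z - 1 = -(s - 1) / s := by
    rw [h1]
    have := rate_ne_zero
    field_simp
    ring
  rw [e3, norm_div, norm_neg, div_le_iff₀ (by linarith)]
  linarith

theorem time_three_im : (time 3).im = 0 := by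
  have h : (3 : ℂ) ∈ bigDomain := Or.inl (Or.inl (by simp [Real.pi_pos]))
  have := time_conj h
  rw [map_ofNat] at this
  exact Complex.conj_eq_iff_im.mp this.symm

/-- Mean value inequality for `rate * time w - w` on a convex truncated cone. -/
theorem norm_time_far {z : ℂ} (hx : 3 ≤ z.re) (hy : |z.im| < Real.pi / 6 * z.re) :
    ‖(rate * time z - z) - (rate * time 3 - 3)‖ ≤ 1 / 20 * ‖z - 3‖ := by
  have hconv : Convex ℝ {w : ℂ | 3 ≤ w.re ∧ |w.im| < Real.pi / 6 * w.re} := by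
    have h1 : Convex ℝ {w : ℂ | 3 ≤ w.re} := convex_halfSpace_re_ge 3
    refine h1.inter ?_
    intro a (ha : |a.im| < Real.pi / 6 * a.re) b (hb : |b.im| < Real.pi / 6 * b.re) s t hs ht hst
    change |(s • a + t • b).im| < Real.pi / 6 * (s • a + t • b).re
    simp only [Complex.add_re, Complex.add_im, Complex.real_smul,
      Complex.re_ofReal_mul, Complex.im_ofReal_mul]
    rw [abs_lt] at ha hb ⊢
    constructor
    · rcases hs.eq_or_lt with rfl | hs
      · have : t = 1 := by linarith
        subst this; linarith [hb.1]
      · nlinarith [mul_lt_mul_of_pos_left ha.1 hs, mul_le_mul_of_nonneg_left hb.1.le ht]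
    · rcases hs.eq_or_lt with rfl | hs
      · have : t = 1 := by linarith
        subst this; linarith [hb.2]
      · nlinarith [mul_lt_mul_of_pos_left ha.2 hs, mul_le_mul_of_nonneg_left hb.2.le ht]
  refine hconv.norm_image_sub_le_of_norm_hasDerivWithin_le
    (f := fun w => rate * time w - w) (f' := fun w => rate * speed w - 1) ?_ ?_ ?_ ⟨hx, hy⟩
  · rintro w ⟨hw1, hw2⟩
    have hmem : w ∈ bigDomain := by
      right
      simp only [Set.mem_ofPred_eq]
      rwa [abs_of_nonneg (by linarith : 0 ≤ w.re)]
    exact (((hasDerivAt_time hmem).const_mul _).sub (hasDerivAt_id w)).hasDerivWithinAt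
  · rintro w ⟨hw1, -⟩
    exact norm_rate_mul_speed_sub_one_le (hw1.trans (le_abs_self _))
  · refine ⟨by simp, ?_⟩
    simp [Real.pi_pos]

/-- Here `Im z` is about `0.26 Re z`. Even after the five per cent error, `rate * Im (time z)`
exceeds `rate * height ≤ 0.5432` by at least `0.06 Re z`. The condition on `m` makes the term in
`|Re (time z)|` fit into this margin. -/
theorem time_cone_boundary {m : ℝ} (hm0 : 0 ≤ m) (hm : m * (rate * |(time 3).re| + 2) ≤ 0.06)
    {z : ℂ} (hx : 3 ≤ z.re) (hy : z.im = Real.pi / 12 * z.re) :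
    height + m * |(time z).re| ≤ (time z).im := by
  have hpi := Real.pi_gt_d2
  have hpi' := Real.pi_lt_d2
  have hr := rate_pos
  have hypos : 0 < z.im := by rw [hy]; positivity
  have h := norm_time_far hx (by rw [abs_of_pos hypos, hy]; nlinarith)
  have hn : ‖z - 3‖ ≤ (z.re - 3) + z.im := by
    refine (Complex.norm_le_abs_re_add_abs_im _).trans ?_
    simp only [Complex.sub_re, Complex.sub_im, Complex.re_ofNat, Complex.im_ofNat, sub_zero]
    rw [abs_of_nonneg (by linarith), abs_of_pos hypos]
  have h1 := (Complex.abs_re_le_norm _).trans (h.trans (by gcongr))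
  have h2 := (Complex.abs_im_le_norm _).trans (h.trans (by gcongr))
  simp only [Complex.sub_re, Complex.sub_im, Complex.re_ofNat, Complex.im_ofNat,
    Complex.re_ofReal_mul, Complex.im_ofReal_mul, time_three_im] at h1 h2
  rw [abs_le] at h1 h2
  have hH := rate_mul_height_le
  have hH' : rate * height ≤ 0.5432 := by
    refine hH.trans ?_
    rw [div_div, div_le_iff₀ (by norm_num)]
    linarith
  have hy1 : 0.2616 * z.re ≤ z.im := by rw [hy]; nlinarith
  have hy2 : z.im ≤ 0.2626 * z.re := by rw [hy]; nlinarith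
  have him : 0.06 * z.re ≤ rate * ((time z).im - height) := by nlinarith
  have hre : rate * |(time z).re| ≤ (rate * |(time 3).re| + 2) * z.re := by
    have e1 : rate * |(time z).re| = |rate * (time z).re| := by
      rw [abs_mul, abs_of_pos hr]
    have e2 : |rate * (time 3).re| = rate * |(time 3).re| := by
      rw [abs_mul, abs_of_pos hr]
    have e3 := abs_le.mp (le_of_eq e2)
    have e4 : 0 ≤ rate * |(time 3).re| := by positivity
    rw [e1]
    have e5 : rate * |(time 3).re| ≤ rate * |(time 3).re| * z.re := by nlinarith
    rw [abs_le]
    constructor <;> nlinarith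
  have key : rate * (m * |(time z).re|) ≤ rate * ((time z).im - height) := by
    calc rate * (m * |(time z).re|) = m * (rate * |(time z).re|) := by ring
      _ ≤ m * ((rate * |(time 3).re| + 2) * z.re) := by gcongr
      _ = m * (rate * |(time 3).re| + 2) * z.re := by ring
      _ ≤ 0.06 * z.re := by gcongr
      _ ≤ _ := him
  linarith [le_of_mul_le_mul_left key hr]

/-! ### The time on the curve where `chSq` is imaginary -/

/-- The curve in the first quadrant on which `chSq` is purely imaginary. -/
noncomputable def edge (x : ℝ) : ℂ :=
  x + ((Real.pi / 2 - Real.arctan (Real.tanh x) : ℝ) : ℂ) * Complex.I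

theorem edge_re (x : ℝ) : (edge x).re = x := by
  rw [edge, Complex.add_re, Complex.re_ofReal_mul, Complex.ofReal_re, Complex.I_re]; ring

theorem edge_im (x : ℝ) : (edge x).im = Real.pi / 2 - Real.arctan (Real.tanh x) := by
  rw [edge, Complex.add_im, Complex.im_ofReal_mul, Complex.ofReal_im, Complex.I_im]; ring

theorem cos_two_arctan_tanh (x : ℝ) :
    Real.cos (2 * Real.arctan (Real.tanh x)) = 1 / Real.cosh (2 * x) := by
  have h1 := Real.cosh_sq x
  have h0 := Real.cosh_pos x
  rw [Real.cos_two_mul, Real.cos_sq_arctan, Real.cosh_two_mul, Real.tanh_eq_sinh_div_cosh]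
  field_simp
  linear_combination h1

theorem sin_two_arctan_tanh (x : ℝ) :
    Real.sin (2 * Real.arctan (Real.tanh x)) = Real.sinh (2 * x) / Real.cosh (2 * x) := by
  have h0 := Real.cosh_pos x
  have h2 : Real.sin (Real.arctan (Real.tanh x)) =
      Real.tanh x * Real.cos (Real.arctan (Real.tanh x)) := by
    rw [Real.sin_arctan, Real.cos_arctan]; ring
  rw [Real.sin_two_mul, h2, Real.sinh_two_mul, Real.cosh_two_mul, Real.tanh_eq_sinh_div_cosh]
  have h3 := Real.cos_sq_arctan (Real.sinh x / Real.cosh x)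
  have h4 : 2 * (Real.sinh x / Real.cosh x * Real.cos (Real.arctan (Real.sinh x / Real.cosh x))) *
      Real.cos (Real.arctan (Real.sinh x / Real.cosh x)) = 2 * (Real.sinh x / Real.cosh x) *
      Real.cos (Real.arctan (Real.sinh x / Real.cosh x)) ^ 2 := by ring
  rw [h4, h3]
  field_simp

theorem chSq_edge (x : ℝ) : chSq (edge x) =
    ((Real.sinh (2 * x) ^ 2 / (2 * Real.cosh (2 * x)) : ℝ) : ℂ) * Complex.I := by
  have h0 := Real.cosh_pos (2 * x)
  have e : 2 * (edge x).im = Real.pi - 2 * Real.arctan (Real.tanh x) := by rw [edge_im]; ring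
  apply Complex.ext
  · rw [chSq_re, e, edge_re, Real.cos_pi_sub, cos_two_arctan_tanh]
    simp only [Complex.re_ofReal_mul, Complex.I_re]
    field_simp
    ring
  · rw [chSq_im, e, edge_re, Real.sin_pi_sub, sin_two_arctan_tanh]
    simp only [Complex.im_ofReal_mul, Complex.I_im]
    field_simp

theorem hasDerivAt_edge (x : ℝ) :
    HasDerivAt edge (1 - ((1 / Real.cosh (2 * x) : ℝ) : ℂ) * Complex.I) x := by
  have h0 := Real.cosh_pos x
  have ht : HasDerivAt Real.tanh (1 / Real.cosh x ^ 2) x := by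
    have h := (Real.hasDerivAt_sinh x).div (Real.hasDerivAt_cosh x) h0.ne'
    have e : Real.tanh = fun y => Real.sinh y / Real.cosh y := by
      ext y; exact Real.tanh_eq_sinh_div_cosh y
    rw [e]
    refine h.congr_deriv ?_
    rw [← sq, ← sq, Real.cosh_sq x]; ring
  have h1 := (ht.arctan.const_sub (Real.pi / 2)).ofReal_comp
  have h2 := (Complex.ofRealCLM.hasDerivAt (x := x)).add (h1.mul_const Complex.I)
  refine h2.congr_deriv ?_
  have e : 1 / (1 + Real.tanh x ^ 2) * (1 / Real.cosh x ^ 2) = 1 / Real.cosh (2 * x) := by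
    rw [Real.cosh_two_mul, Real.tanh_eq_sinh_div_cosh]; field_simp
  rw [e]
  simp only [Complex.ofRealCLM_apply, Complex.ofReal_one, Complex.ofReal_neg]
  ring

theorem edge_mem_bigDomain {x : ℝ} (hx : 0 ≤ x) : edge x ∈ bigDomain := by
  have hpi := Real.pi_gt_three
  have hpi' := Real.pi_lt_d2
  have h1 := Real.arctan_lt_pi_div_two (Real.tanh x)
  rcases hx.eq_or_lt with rfl | hx
  · left; right
    refine ⟨by simp [edge_re], ?_⟩
    rw [edge_im, Real.tanh_zero, Real.arctan_zero, sub_zero, abs_of_pos (by linarith)]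
    linarith
  · left; left
    have h2 : 0 < Real.arctan (Real.tanh x) := by
      rw [Real.arctan_pos, Real.tanh_eq_sinh_div_cosh]
      exact div_pos (Real.sinh_pos_iff.mpr hx) (Real.cosh_pos x)
    simp only [Set.mem_ofPred_eq, edge_im]
    rw [abs_of_pos (by linarith)]
    linarith

/-- On the edge `chSq = iσ`, so `1 + k / chSq` has real part 1. Rationalizing the denominator of
`speed²` leaves a positive multiple of `(σ + i cp)(σ + i cr)`, with positive imaginary part. -/
theorem speed_edge {x σ : ℝ} (hx : 0 < x)
    (hσ : σ = Real.sinh (2 * x) ^ 2 / (2 * Real.cosh (2 * x))) :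
    0 < (speed (edge x)).re ∧ 0 < (speed (edge x)).im ∧
      ∃ K : ℝ, 0 < K ∧ speed (edge x) ^ 2 =
        (K : ℂ) * ((σ + cp * Complex.I) * (σ + cr * Complex.I)) := by
  have hp := cp_pos
  have hr := cr_pos
  have hmu := rate_pos
  have hC0 : 0 < Real.cosh (2 * x) := Real.cosh_pos _
  have hsh : 0 < Real.sinh (2 * x) := Real.sinh_pos_iff.mpr (by linarith)
  have hσ0 : 0 < σ := by rw [hσ]; positivity
  have hD : chSq (edge x) = (σ : ℂ) * Complex.I := by rw [hσ]; exact chSq_edge x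
  have hoff := offCut_of_mem (edge_mem_bigDomain hx.le)
  have hσne : (σ : ℂ) ≠ 0 := Complex.ofReal_ne_zero.mpr hσ0.ne'
  have hD0 : chSq (edge x) ≠ 0 := by rw [hD]; exact mul_ne_zero hσne Complex.I_ne_zero
  have hre1 : ∀ k : ℝ, 0 < (1 + k / chSq (edge x)).re := by
    intro k
    have : (k : ℂ) / ((σ : ℂ) * Complex.I) = ((k / σ : ℝ) : ℂ) * -Complex.I := by
      push_cast
      rw [← Complex.inv_I]
      field_simp
    rw [hD, this]
    simp
  have hvre : 0 < (speed (edge x)).re := speed_re_pos_of hD0 (hre1 cp) (hre1 cr)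
  set K := σ ^ 2 / (rate ^ 2 * (σ ^ 2 + cp ^ 2) * (σ ^ 2 + cr ^ 2)) with hK
  have hK0 : 0 < K := by positivity
  have hfac : ∀ k : ℝ, ((σ ^ 2 + k ^ 2 : ℝ) : ℂ) =
      (σ * Complex.I + k) * -((σ + k * Complex.I) * Complex.I) := by
    intro k
    push_cast
    linear_combination ((σ : ℂ) ^ 2 + k ^ 2 + σ * k * Complex.I) * Complex.I_sq
  have hne : ∀ k : ℝ, 0 < k → (σ : ℂ) + k * Complex.I ≠ 0 := by
    intro k hk h
    have := congrArg Complex.re h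
    simp at this
    exact hσ0.ne' this
  have hv2 : speed (edge x) ^ 2 =
      (K : ℂ) * ((σ + cp * Complex.I) * (σ + cr * Complex.I)) := by
    have h1 := hoff.add_cp_ne_zero
    have h2 := hoff.add_cr_ne_zero
    rw [hD] at h1 h2
    have hμ := rate_ne_zero
    have hKc : (K : ℂ) = (σ : ℂ) ^ 2 / ((rate : ℂ) ^ 2 * ((σ ^ 2 + cp ^ 2 : ℝ) : ℂ) *
        ((σ ^ 2 + cr ^ 2 : ℝ) : ℂ)) := by
      rw [hK]; push_cast; rfl
    have h5 := hne cp hp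
    have h6 := hne cr hr
    rw [speed_sq hoff, hD, hKc, hfac, hfac]
    generalize (σ : ℂ) + cp * Complex.I = P at *
    generalize (σ : ℂ) + cr * Complex.I = R at *
    generalize (σ : ℂ) * Complex.I + cp = a at *
    generalize (σ : ℂ) * Complex.I + cr = b at *
    have hE : (rate : ℂ) ^ 2 * (a * -(P * Complex.I)) * (b * -(R * Complex.I)) =
        -((rate : ℂ) ^ 2 * a * b * (P * R)) := by
      linear_combination ((rate : ℂ) ^ 2 * a * b * (P * R)) * Complex.I_sq
    rw [hE, mul_pow, Complex.I_sq]
    field_simp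
  refine ⟨hvre, ?_, K, hK0, hv2⟩
  have := congrArg Complex.im hv2
  rw [sq, Complex.mul_im, Complex.im_ofReal_mul] at this
  simp only [Complex.mul_im, Complex.add_re, Complex.add_im, Complex.ofReal_re,
    Complex.ofReal_im, Complex.re_ofReal_mul, Complex.I_re, Complex.I_im] at this
  have h7 : 0 < K * (σ * (cp + cr)) := by positivity
  by_contra hc
  have := mul_nonneg hvre.le (by linarith : 0 ≤ -(speed (edge x)).im)
  linarith

/-- The hypotheses give `Re² ≤ Im² + 2S Re Im` for `g`, which fails if `(2S + 1) Im < Re`. -/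
theorem le_im_of_sq_eq {g : ℂ} {k σ B S : ℝ} (hg : 0 < g.re) (hk : 0 < k) (hB : 0 < B)
    (hS : 0 < S) (hσB : σ ^ 3 ≤ S * B)
    (h : g ^ 2 = (k : ℂ) * (((σ ^ 3 : ℝ) : ℂ) + (B : ℂ) * Complex.I)) :
    1 / (2 * S + 1) * g.re ≤ g.im := by
  have hq1 := congrArg Complex.re h
  have hq2 := congrArg Complex.im h
  rw [sq, Complex.mul_re, Complex.re_ofReal_mul] at hq1
  rw [sq, Complex.mul_im, Complex.im_ofReal_mul] at hq2
  simp only [Complex.add_re, Complex.add_im, Complex.ofReal_re, Complex.ofReal_im,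
    Complex.re_ofReal_mul, Complex.im_ofReal_mul, Complex.I_re, Complex.I_im, mul_zero, add_zero,
    mul_one, zero_add] at hq1 hq2
  have hgim : 0 < g.im := by
    have := mul_pos hk hB
    by_contra hc
    have := mul_nonneg hg.le (by linarith : 0 ≤ -g.im)
    linarith
  have hineq : g.re * g.re ≤ g.im * g.im + 2 * S * (g.re * g.im) := by
    have h1 := mul_le_mul_of_nonneg_left hσB hk.le
    have h2 : 2 * S * (g.re * g.im) = k * (S * B) := by linear_combination S * hq2
    linarith
  by_contra hc
  rw [not_le, one_div, inv_mul_eq_div, lt_div_iff₀ (by positivity)] at hc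
  have hlt : g.im < g.re := by linarith [mul_pos hS hgim]
  have a1 := mul_lt_mul_of_pos_right hc hg
  have a2 := mul_lt_mul_of_pos_right hlt hgim
  linarith

/-- The velocity of `time` along the edge has a square in the open first quadrant, hence positive
slope; the slope degenerates as `x` grows, which is why a bound `S` enters. -/
theorem edge_derivative_bounds {x : ℝ} (hx : 0 < x) {S : ℝ}
    (hS : Real.cosh (2 * x) / 2 ≤ S) :
    0 < (speed (edge x) * (1 - ((1 / Real.cosh (2 * x) : ℝ) : ℂ) * Complex.I)).re ∧
      1 / (2 * S + 1) *
        (speed (edge x) * (1 - ((1 / Real.cosh (2 * x) : ℝ) : ℂ) * Complex.I)).re ≤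
      (speed (edge x) * (1 - ((1 / Real.cosh (2 * x) : ℝ) : ℂ) * Complex.I)).im := by
  obtain ⟨hvre, hvim, K, hK0, hv2⟩ := speed_edge hx rfl
  have hp := cp_gt
  have hr := cr_gt
  set C := Real.cosh (2 * x) with hC
  have hC0 : 0 < C := Real.cosh_pos _
  have hsh : 0 < Real.sinh (2 * x) := Real.sinh_pos_iff.mpr (by linarith)
  have hCs : Real.sinh (2 * x) ^ 2 = C ^ 2 - 1 := by rw [hC, Real.cosh_sq]; ring
  set σ := Real.sinh (2 * x) ^ 2 / (2 * C) with hσ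
  have hσ0 : 0 < σ := by positivity
  have hσC : C ^ 2 - 1 = 2 * C * σ := by rw [hσ, hCs]; field_simp
  have hσS : σ ≤ S := by
    refine le_trans ?_ hS
    rw [hσ, hCs, div_le_div_iff₀ (by positivity) (by norm_num)]
    linarith
  have hS0 : 0 < S := hσ0.trans_le hσS
  set v := speed (edge x) with hv
  set g := v * (1 - ((1 / C : ℝ) : ℂ) * Complex.I) with hg
  have hgre : 0 < g.re := by
    have : g.re = v.re + v.im * (1 / C) := by
      rw [hg, Complex.mul_re]
      simp
    rw [this]; positivity
  have hfac : (1 - ((1 / C : ℝ) : ℂ) * Complex.I) ^ 2 =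
      ((2 / C : ℝ) : ℂ) * (σ - Complex.I) := by
    have hCne : (C : ℂ) ≠ 0 := Complex.ofReal_ne_zero.mpr hC0.ne'
    have h8 : (C : ℂ) ^ 2 - 1 = 2 * C * σ := by exact_mod_cast congrArg (fun r : ℝ => (r : ℂ)) hσC
    push_cast
    field_simp
    linear_combination h8 + Complex.I_sq
  have hpr : ((cp : ℂ) + cr) = cp * cr := by exact_mod_cast congrArg (fun r : ℝ => (r : ℂ)) cp_add_cr
  -- Expanding `(σ - i)(σ + i cp)(σ + i cr)`, the terms linear in `σ` cancel by `cp + cr = cp * cr`,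
  -- so the real part is `σ³ > 0`.
  have hg2 : g ^ 2 = ((K * (2 / C) : ℝ) : ℂ) *
      (((σ ^ 3 : ℝ) : ℂ) + ((cp * cr + (cp * cr - 1) * σ ^ 2 : ℝ) : ℂ) * Complex.I) := by
    rw [hg, mul_pow, hv2, hfac]
    push_cast
    linear_combination ((K : ℂ) * (2 / C)) * (σ * Complex.I * (σ - Complex.I) * hpr -
      cp * cr * Complex.I * Complex.I_sq)
  have hpr3 : 3 < cp * cr := by nlinarith
  refine ⟨hgre, le_im_of_sq_eq hgre (by positivity) ?_ hS0 ?_ hg2⟩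
  · have : 0 < cp * cr - 1 := by linarith
    positivity
  · have h9 : σ ^ 2 ≤ cp * cr + (cp * cr - 1) * σ ^ 2 := by nlinarith [sq_nonneg σ]
    calc σ ^ 3 = σ * σ ^ 2 := by ring
      _ ≤ S * (cp * cr + (cp * cr - 1) * σ ^ 2) := by gcongr

/-- The edge starts at `iπ/2`, where the time is `i * height`; the slope bound is then integrated
along it. The constant is `1/(2S + 1)` with `S = cosh 12 / 2`, as `2x ≤ 12`. -/
theorem time_edge_bound {x : ℝ} (hx0 : 0 ≤ x) (hx : x ≤ 6) :
    height + 1 / (Real.cosh 12 + 1) * |(time (edge x)).re| ≤ (time (edge x)).im := by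
  set m := 1 / (Real.cosh 12 + 1) with hm
  have hd : ∀ y ∈ Set.Icc (0 : ℝ) 6, HasDerivAt (fun s => time (edge s))
      (speed (edge y) * (1 - ((1 / Real.cosh (2 * y) : ℝ) : ℂ) * Complex.I)) y := fun y hy =>
    HasDerivAt.comp (h₂ := time) y (hasDerivAt_time (edge_mem_bigDomain hy.1)) (hasDerivAt_edge y)
  have hb : ∀ y ∈ Set.Ioo (0 : ℝ) 6, 0 <
      (speed (edge y) * (1 - ((1 / Real.cosh (2 * y) : ℝ) : ℂ) * Complex.I)).re ∧ m *
      (speed (edge y) * (1 - ((1 / Real.cosh (2 * y) : ℝ) : ℂ) * Complex.I)).re ≤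
      (speed (edge y) * (1 - ((1 / Real.cosh (2 * y) : ℝ) : ℂ) * Complex.I)).im := by
    intro y hy
    have hS : Real.cosh (2 * y) / 2 ≤ Real.cosh 12 / 2 := by
      have : Real.cosh (2 * y) ≤ Real.cosh 12 := by
        rw [Real.cosh_le_cosh, abs_of_pos (by linarith [hy.1]), abs_of_pos (by norm_num)]
        linarith [hy.2]
      linarith
    have := edge_derivative_bounds hy.1 hS
    have e : 2 * (Real.cosh 12 / 2) + 1 = Real.cosh 12 + 1 := by ring
    rwa [e] at this
  have hre : ∀ y ∈ Set.Icc (0 : ℝ) 6, HasDerivAt (fun s => (time (edge s)).re)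
      (speed (edge y) * (1 - ((1 / Real.cosh (2 * y) : ℝ) : ℂ) * Complex.I)).re y := fun y hy =>
    Complex.reCLM.hasFDerivAt.comp_hasDerivAt y (hd y hy)
  have him : ∀ y ∈ Set.Icc (0 : ℝ) 6, HasDerivAt (fun s => (time (edge s)).im)
      (speed (edge y) * (1 - ((1 / Real.cosh (2 * y) : ℝ) : ℂ) * Complex.I)).im y := fun y hy =>
    Complex.imCLM.hasFDerivAt.comp_hasDerivAt y (hd y hy)
  have he0 : edge 0 = (Real.pi / 2 : ℝ) * Complex.I := by simp [edge]
  have ht0 : time (edge 0) = height * Complex.I := by rw [he0, time_pi_div_two]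
  have hmono1 : MonotoneOn (fun s => (time (edge s)).re) (Set.Icc 0 6) := by
    refine monotoneOn_of_hasDerivWithinAt_nonneg (convex_Icc 0 6)
      (fun y hy => (hre y hy).continuousAt.continuousWithinAt)
      (fun y hy => (hre y (interior_subset hy)).hasDerivWithinAt) fun y hy => ?_
    rw [interior_Icc] at hy
    exact (hb y hy).1.le
  have hmono2 : MonotoneOn (fun s => (time (edge s)).im - m * (time (edge s)).re)
      (Set.Icc 0 6) := by
    refine monotoneOn_of_hasDerivWithinAt_nonneg (convex_Icc 0 6)
      (fun y hy => ((him y hy).sub ((hre y hy).const_mul m)).continuousAt.continuousWithinAt)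
      (fun y hy => ((him y (interior_subset hy)).sub
        ((hre y (interior_subset hy)).const_mul m)).hasDerivWithinAt) fun y hy => ?_
    rw [interior_Icc] at hy
    linarith [(hb y hy).2]
  have h0 : (0 : ℝ) ∈ Set.Icc (0 : ℝ) 6 := ⟨le_rfl, by norm_num⟩
  have h1 := hmono1 h0 ⟨hx0, hx⟩ hx0
  have h2 := hmono2 h0 ⟨hx0, hx⟩ hx0
  simp only [ht0, Complex.re_ofReal_mul, Complex.im_ofReal_mul, Complex.I_re, Complex.I_im,
    mul_zero, mul_one, sub_zero] at h1 h2
  rw [abs_of_nonneg h1]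
  linarith

/-! ### The boundary of the region -/

/-- For `|Re z| > 6` the strip of half-width `π/2` lies inside the cone, and for `|Re z| < 3` the
closed cone lies inside the central part, so only two kinds of boundary arc survive. -/
theorem frontier_region_subset {z : ℂ} (hz : z ∈ closure region) (hz' : z ∉ region) :
    (1 + Real.cosh (2 * z.re) * Real.cos (2 * z.im) = 0 ∧ |z.im| ≤ Real.pi / 2 ∧ |z.re| ≤ 6) ∨
      (|z.im| = Real.pi / 12 * |z.re| ∧ 3 ≤ |z.re|) := by
  have hpi := Real.pi_pos
  have hcont : Continuous fun z : ℂ => 1 + Real.cosh (2 * z.re) * Real.cos (2 * z.im) :=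
    continuous_const.add ((Real.continuous_cosh.comp (by fun_prop)).mul (by fun_prop))
  have hcone : ¬ |z.im| < Real.pi / 12 * |z.re| := fun h => hz' (Or.inr h)
  have hcent : ¬ (|z.im| < Real.pi / 2 ∧
      0 < 1 + Real.cosh (2 * z.re) * Real.cos (2 * z.im)) := fun h => hz' (Or.inl h)
  rw [region, closure_union] at hz
  rcases hz with hz | hz
  · left
    have hcl : IsClosed {z : ℂ | |z.im| ≤ Real.pi / 2 ∧
        0 ≤ 1 + Real.cosh (2 * z.re) * Real.cos (2 * z.im)} :=
      (isClosed_le Complex.continuous_im.abs continuous_const).inter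
        (isClosed_le continuous_const hcont)
    have hsub : {z : ℂ | |z.im| < Real.pi / 2 ∧
        0 < 1 + Real.cosh (2 * z.re) * Real.cos (2 * z.im)} ⊆ {z : ℂ | |z.im| ≤ Real.pi / 2 ∧
        0 ≤ 1 + Real.cosh (2 * z.re) * Real.cos (2 * z.im)} :=
      fun w hw => ⟨le_of_lt hw.1, le_of_lt hw.2⟩
    obtain ⟨h1, h2⟩ := closure_minimal hsub hcl hz
    refine ⟨?_, h1, ?_⟩
    · rcases h1.eq_or_lt with h3 | h3
      · have h4 : Real.cos (2 * z.im) = -1 := by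
          rw [← Real.cos_abs, abs_mul, h3, abs_of_pos two_pos, mul_div_cancel₀ _ two_ne_zero,
            Real.cos_pi]
        rw [h4] at h2 ⊢
        linarith [Real.one_le_cosh (2 * z.re)]
      · exact le_antisymm (not_lt.mp fun h => hcent ⟨h3, h⟩) h2
    · by_contra hc
      rw [not_le] at hc
      exact hcone (by nlinarith)
  · right
    have hcl : IsClosed {z : ℂ | |z.im| ≤ Real.pi / 12 * |z.re|} :=
      isClosed_le Complex.continuous_im.abs (continuous_const.mul Complex.continuous_re.abs)
    have hsub : {z : ℂ | |z.im| < Real.pi / 12 * |z.re|} ⊆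
        {z : ℂ | |z.im| ≤ Real.pi / 12 * |z.re|} :=
      Set.ofPred_subset_ofPred.mpr fun w hw => le_of_lt hw
    have h1 : |z.im| ≤ Real.pi / 12 * |z.re| := closure_minimal hsub hcl hz
    refine ⟨le_antisymm h1 (not_lt.mp hcone), ?_⟩
    by_contra hc
    exact hz' (mem_region_of_le h1 (not_le.mp hc))

theorem mem_bigDomain_abs_iff (z : ℂ) : (⟨|z.re|, |z.im|⟩ : ℂ) ∈ bigDomain ↔ z ∈ bigDomain := by
  simp only [bigDomain, Set.mem_union, Set.mem_ofPred_eq, abs_abs]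

/-- `time` is odd and commutes with conjugation, which reduces boundary estimates to the first
quadrant. -/
theorem time_abs {z : ℂ} (hz : z ∈ bigDomain) :
    |(time ⟨|z.re|, |z.im|⟩).re| = |(time z).re| ∧
      |(time ⟨|z.re|, |z.im|⟩).im| = |(time z).im| := by
  have hc : |(time ((starRingEnd ℂ) z)).re| = |(time z).re| ∧
      |(time ((starRingEnd ℂ) z)).im| = |(time z).im| := by
    rw [time_conj hz]; simp
  have hn : ∀ w : ℂ, |(time (-w)).re| = |(time w).re| ∧ |(time (-w)).im| = |(time w).im| := by
    intro w
    rw [time_neg]; simp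
  rcases abs_cases z.re with ⟨h1, -⟩ | ⟨h1, -⟩ <;> rcases abs_cases z.im with ⟨h2, -⟩ | ⟨h2, -⟩
  · rw [h1, h2]; exact ⟨rfl, rfl⟩
  · have e : (⟨|z.re|, |z.im|⟩ : ℂ) = (starRingEnd ℂ) z := by
      apply Complex.ext <;> simp [h1, h2]
    rw [e]; exact hc
  · have e : (⟨|z.re|, |z.im|⟩ : ℂ) = -((starRingEnd ℂ) z) := by
      apply Complex.ext <;> simp [h1, h2]
    rw [e, (hn _).1, (hn _).2]; exact hc
  · have e : (⟨|z.re|, |z.im|⟩ : ℂ) = -z := by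
      apply Complex.ext <;> simp [h1, h2]
    rw [e]; exact hn z

theorem edge_eq_of {x y : ℝ} (hy0 : 0 ≤ y) (hy : y ≤ Real.pi / 2)
    (hx : 0 ≤ x) (h : 1 + Real.cosh (2 * x) * Real.cos (2 * y) = 0) : (⟨x, y⟩ : ℂ) = edge x := by
  have h0 := Real.cosh_pos (2 * x)
  have hpi := Real.pi_pos
  have h2 : 0 ≤ Real.arctan (Real.tanh x) := by
    rw [Real.arctan_nonneg, Real.tanh_eq_sinh_div_cosh]
    exact div_nonneg (Real.sinh_nonneg_iff.mpr hx) (Real.cosh_pos x).le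
  have h3 := Real.arctan_lt_pi_div_two (Real.tanh x)
  have h4 : Real.cos (2 * y) = Real.cos (Real.pi - 2 * Real.arctan (Real.tanh x)) := by
    rw [Real.cos_pi_sub, cos_two_arctan_tanh]
    field_simp
    linarith
  have h5 := Real.injOn_cos ⟨by linarith, by linarith⟩ ⟨by linarith, by linarith⟩ h4
  apply Complex.ext
  · rw [edge_re]
  · rw [edge_im]; linarith

/-- On the boundary of the region the time lies outside a bow tie. -/
theorem exists_slope : ∃ m : ℝ, 0 < m ∧ ∀ z ∈ closure region, z ∉ region →
    z ∈ bigDomain ∧ height + m * |(time z).re| ≤ |(time z).im| := by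
  set k := rate * |(time 3).re| + 2 with hk
  have hk0 : 0 < k := by
    have := rate_pos
    positivity
  have hC := Real.cosh_pos 12
  -- The two bounds serve the cone boundary and the edge respectively.
  refine ⟨min (0.06 / k) (1 / (Real.cosh 12 + 1)), lt_min (by positivity) (by positivity), ?_⟩
  intro z hz hz'
  set m := min (0.06 / k) (1 / (Real.cosh 12 + 1)) with hm
  have hm0 : 0 ≤ m := le_min (by positivity) (by positivity)
  suffices h : (⟨|z.re|, |z.im|⟩ : ℂ) ∈ bigDomain ∧
      height + m * |(time ⟨|z.re|, |z.im|⟩).re| ≤ (time ⟨|z.re|, |z.im|⟩).im by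
    have hb := (mem_bigDomain_abs_iff z).mp h.1
    refine ⟨hb, ?_⟩
    obtain ⟨h1, h2⟩ := time_abs hb
    rw [← h1, ← h2]
    exact h.2.trans (le_abs_self _)
  rcases frontier_region_subset hz hz' with ⟨h1, h2, h3⟩ | ⟨h1, h2⟩
  · have e : (⟨|z.re|, |z.im|⟩ : ℂ) = edge |z.re| := by
      refine edge_eq_of (abs_nonneg _) h2 (abs_nonneg _) ?_
      have e1 : Real.cosh (2 * |z.re|) = Real.cosh (2 * z.re) := by
        rw [← Real.cosh_abs (2 * z.re), abs_mul, abs_of_pos (two_pos : (0 : ℝ) < 2)]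
      have e2 : Real.cos (2 * |z.im|) = Real.cos (2 * z.im) := by
        rw [← Real.cos_abs (2 * z.im), abs_mul, abs_of_pos (two_pos : (0 : ℝ) < 2)]
      rw [e1, e2, h1]
    rw [e]
    refine ⟨edge_mem_bigDomain (abs_nonneg _), le_trans ?_ (time_edge_bound (abs_nonneg _) h3)⟩
    gcongr
    exact min_le_right _ _
  · constructor
    · right
      change |(|z.im|)| < Real.pi / 6 * |(|z.re|)|
      rw [abs_abs, abs_abs, h1]
      nlinarith [Real.pi_pos]
    · refine time_cone_boundary hm0 ?_ h2 h1
      calc m * k ≤ 0.06 / k * k := by gcongr; exact min_le_left _ _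
        _ = 0.06 := by field_simp

/-! ### Inversion of the time -/

/-- The bow tie whose boundary lines have slope `m`. -/
def slopedBowTie (m : ℝ) : Set ℂ := {t | |t.im| < m * |t.re| + height}

theorem isOpen_slopedBowTie (m : ℝ) : IsOpen (slopedBowTie m) :=
  isOpen_lt Complex.continuous_im.abs
    ((continuous_const.mul Complex.continuous_re.abs).add continuous_const)

theorem zero_mem_slopedBowTie (m : ℝ) : (0 : ℂ) ∈ slopedBowTie m := by
  change |(0 : ℂ).im| < m * |(0 : ℂ).re| + height
  simpa using height_pos

theorem isPreconnected_slopedBowTie (m : ℝ) : IsPreconnected (slopedBowTie m) := by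
  have hstar : StarConvex ℝ 0 (slopedBowTie m) := by
    rw [starConvex_zero_iff]
    intro t (ht : |t.im| < m * |t.re| + height) s hs0 hs1
    change |(s • t).im| < m * |(s • t).re| + height
    rw [Complex.real_smul, Complex.im_ofReal_mul, Complex.re_ofReal_mul, abs_mul, abs_mul,
      abs_of_nonneg hs0]
    have hh := height_pos
    rcases hs0.eq_or_lt with rfl | hs0
    · simpa using hh
    · nlinarith [mul_lt_mul_of_pos_left ht hs0]
  exact (hstar.isPathConnected (zero_mem_slopedBowTie m)).isConnected.isPreconnected

/-- Bounded time forces bounded `z`: for `|Re z| ≥ 3` compare `rate * time` with the identity, using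
oddness on the left; otherwise `|z| < 5`. -/
theorem norm_le_time {z : ℂ} (hz : z ∈ region) :
    ‖z‖ ≤ 2 * (rate * ‖time z‖ + ‖(rate * time 3 - 3 : ℂ)‖ + 1) + 5 := by
  have hpi := Real.pi_gt_three
  have hpi' := Real.pi_lt_d2
  have hr := rate_pos
  have hright : ∀ w : ℂ, 3 ≤ w.re → |w.im| < Real.pi / 6 * w.re →
      ‖w‖ ≤ 2 * (rate * ‖time w‖ + ‖(rate * time 3 - 3 : ℂ)‖ + 1) + 5 := by
    intro w h1 h2
    have h3 := norm_time_far h1 h2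
    have h4 : ‖w - 3‖ ≤ ‖w‖ + 3 := (norm_sub_le _ _).trans (by simp)
    have h5 : ‖w‖ ≤ ‖rate * time w‖ + ‖(rate * time 3 - 3 : ℂ)‖ +
        ‖(rate * time w - w) - (rate * time 3 - 3)‖ := by
      have e : w = rate * time w - (rate * time 3 - 3) -
          ((rate * time w - w) - (rate * time 3 - 3)) := by ring
      calc ‖w‖ = ‖rate * time w - (rate * time 3 - 3) -
          ((rate * time w - w) - (rate * time 3 - 3))‖ := by rw [← e]
        _ ≤ _ := (norm_sub_le _ _).trans (by gcongr; exact norm_sub_le _ _)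
    rw [norm_mul, Complex.norm_real, Real.norm_eq_abs, abs_of_pos hr] at h5
    have h6 := norm_nonneg (time w)
    have h7 := norm_nonneg (rate * time 3 - 3 : ℂ)
    nlinarith [mul_nonneg hr.le h6]
  have h7 := norm_nonneg (rate * time 3 - 3 : ℂ)
  have h8 := mul_nonneg hr.le (norm_nonneg (time z))
  by_cases hx : 3 ≤ |z.re|
  · have him : |z.im| < Real.pi / 6 * |z.re| := by
      rcases hz with hz | hz
      · have := hz.1
        nlinarith
      · have hz' : |z.im| < Real.pi / 12 * |z.re| := hz
        nlinarith
    rcases abs_cases z.re with ⟨h1, -⟩ | ⟨h1, -⟩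
    · rw [h1] at hx him
      exact hright z hx him
    · rw [h1] at hx him
      have := hright (-z) (by simpa using hx) (by simpa using him)
      rwa [norm_neg, time_neg, norm_neg] at this
  · have him : |z.im| < 2 := by
      rcases hz with hz | hz
      · have := hz.1
        linarith
      · have hz' : |z.im| < Real.pi / 12 * |z.re| := hz
        nlinarith
    linarith [Complex.norm_le_abs_re_add_abs_im z]

/-- A sequence with convergent times is bounded by `norm_le_time`. A limit point on the boundary of
`region` would have its time outside the bow tie. -/
theorem time_proper {m : ℝ} (hm : ∀ z ∈ closure region, z ∉ region →
      z ∈ bigDomain ∧ height + m * |(time z).re| ≤ |(time z).im|)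
    (u : ℕ → ℂ) (t : ℂ) (hu : ∀ n, u n ∈ region) (ht : t ∈ slopedBowTie m)
    (hlim : Tendsto (fun n => time (u n)) atTop (𝓝 t)) :
    ∃ z ∈ region, ∃ φ : ℕ → ℕ, StrictMono φ ∧ Tendsto (u ∘ φ) atTop (𝓝 z) := by
  obtain ⟨R, hR⟩ := (Metric.isBounded_range_of_tendsto _ hlim).exists_norm_le
  set R' := 2 * (rate * R + ‖(rate * time 3 - 3 : ℂ)‖ + 1) + 5 with hR'
  have hb : ∀ n, u n ∈ region ∩ Metric.closedBall 0 R' := by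
    intro n
    refine ⟨hu n, ?_⟩
    rw [mem_closedBall_zero_iff]
    refine (norm_le_time (hu n)).trans ?_
    have := hR _ ⟨n, rfl⟩
    have := rate_pos
    rw [hR']
    gcongr
  obtain ⟨z, hz, φ, hφ, hlimz⟩ := tendsto_subseq_of_bounded
    (Metric.isBounded_closedBall.subset Set.inter_subset_right) hb
  have hzc : z ∈ closure region := closure_mono Set.inter_subset_left hz
  refine ⟨z, ?_, φ, hφ, hlimz⟩
  by_contra hzr
  obtain ⟨h1, h2⟩ := hm z hzc hzr
  have h3 : time z = t := tendsto_nhds_unique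
    ((hasDerivAt_time h1).continuousAt.tendsto.comp hlimz) (hlim.comp hφ.tendsto_atTop)
  rw [h3] at h2
  have h4 : |t.im| < m * |t.re| + height := ht
  linarith

/-! ### The fibre over time zero, and the inverse -/

theorem vertical_mem_region {z : ℂ} (hz : z ∈ region) {s : ℝ} (hs : s ∈ Set.Icc (0 : ℝ) 1) :
    (⟨z.re, s * z.im⟩ : ℂ) ∈ region := by
  have h1 : |s * z.im| ≤ |z.im| := by
    rw [abs_mul, abs_of_nonneg hs.1]; exact mul_le_of_le_one_left (abs_nonneg _) hs.2
  rcases hz with ⟨h2, h3⟩ | hz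
  · left
    refine ⟨h1.trans_lt h2, ?_⟩
    have h4 : Real.cos (2 * z.im) ≤ Real.cos (2 * (s * z.im)) := by
      rw [← Real.cos_abs (2 * z.im), ← Real.cos_abs (2 * (s * z.im)), abs_mul, abs_mul 2 (s * z.im),
        abs_of_pos (two_pos : (0 : ℝ) < 2)]
      exact Real.cos_le_cos_of_nonneg_of_le_pi (by positivity) (by linarith) (by linarith)
    have := mul_le_mul_of_nonneg_left h4 (Real.cosh_pos (2 * z.re)).le
    change 0 < 1 + Real.cosh (2 * z.re) * Real.cos (2 * (s * z.im))
    linarith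
  · right
    exact h1.trans_lt hz

theorem ofReal_mem_region (x : ℝ) : (x : ℂ) ∈ region := by
  left
  refine ⟨by simp [Real.pi_pos], ?_⟩
  have := Real.cosh_pos (2 * x)
  simp
  linarith

theorem lt_of_hasDerivAt_pos {f f' : ℝ → ℝ} (hf : ∀ s ∈ Set.Icc (0 : ℝ) 1, HasDerivAt f (f' s) s)
    (hf' : ∀ s ∈ Set.Icc (0 : ℝ) 1, 0 < f' s) : f 0 < f 1 := by
  refine strictMonoOn_of_hasDerivWithinAt_pos (convex_Icc 0 1)
    (fun s hs => (hf s hs).continuousAt.continuousWithinAt)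
    (fun s hs => (hf s (interior_subset hs)).hasDerivWithinAt)
    (fun s hs => hf' s (interior_subset hs)) ?_ ?_ one_pos
  · exact ⟨le_rfl, zero_le_one⟩
  · exact ⟨zero_le_one, le_rfl⟩

/-- Since `Re speed > 0`, `Im time` is strictly monotone along the vertical segment from the real
axis to `z`, so `z` is real. Monotonicity of `time` on the real axis then gives `z = 0`. -/
theorem eq_zero_of_time_eq_zero {z : ℂ} (hz : z ∈ region) (h : time z = 0) : z = 0 := by
  have him : z.im = 0 := by
    by_contra hne
    have hd : ∀ s ∈ Set.Icc (0 : ℝ) 1, HasDerivAt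
        (fun s : ℝ => z.im * (time (z.re + (s * z.im : ℝ) * Complex.I)).im)
        (z.im * (speed (z.re + (s * z.im : ℝ) * Complex.I) * (z.im * Complex.I)).im) s := by
      intro s hs
      have hmem : (z.re + (s * z.im : ℝ) * Complex.I : ℂ) ∈ region := by
        rw [← Complex.mk_eq_add_mul_I]; exact vertical_mem_region hz hs
      have h1 : HasDerivAt (fun s : ℝ => (z.re + (s * z.im : ℝ) * Complex.I : ℂ))
          (z.im * Complex.I) s := by
        have := ((((hasDerivAt_id s).mul_const z.im).ofReal_comp).mul_const Complex.I).const_add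
          (z.re : ℂ)
        simpa using this
      have h2 := HasDerivAt.comp (h₂ := time) s (hasDerivAt_time (region_subset_bigDomain hmem)) h1
      exact (Complex.imCLM.hasFDerivAt.comp_hasDerivAt s h2).const_mul z.im
    have hlt := lt_of_hasDerivAt_pos hd ?_
    · have e1 : (z.re + (1 * z.im : ℝ) * Complex.I : ℂ) = z := by
        rw [one_mul]; exact Complex.re_add_im z
      have e0 : (time (z.re + (0 * z.im : ℝ) * Complex.I)).im = 0 := by
        have e : (z.re + (0 * z.im : ℝ) * Complex.I : ℂ) = z.re := by simp
        have := time_conj (region_subset_bigDomain (ofReal_mem_region z.re))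
        rw [Complex.conj_ofReal] at this
        rw [e]
        exact Complex.conj_eq_iff_im.mp this.symm
      rw [e1, e0, h] at hlt
      simp at hlt
    · intro s hs
      have hmem : (z.re + (s * z.im : ℝ) * Complex.I : ℂ) ∈ region := by
        rw [← Complex.mk_eq_add_mul_I]; exact vertical_mem_region hz hs
      have hp := speed_re_pos hmem
      have e : z.im * (speed (z.re + (s * z.im : ℝ) * Complex.I) * (z.im * Complex.I)).im =
          z.im ^ 2 * (speed (z.re + (s * z.im : ℝ) * Complex.I)).re := by
        rw [Complex.mul_im, Complex.re_ofReal_mul, Complex.im_ofReal_mul, Complex.I_re,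
          Complex.I_im]
        ring
      rw [e]
      have : 0 < z.im ^ 2 := by positivity
      positivity
  have hz' : z = (z.re : ℂ) := by
    apply Complex.ext <;> simp [him]
  have hre : z.re = 0 := by
    by_contra hne
    have hd : ∀ s ∈ Set.Icc (0 : ℝ) 1, HasDerivAt
        (fun s : ℝ => z.re * (time ((s * z.re : ℝ) : ℂ)).re)
        (z.re * (speed ((s * z.re : ℝ) : ℂ) * (z.re : ℂ)).re) s := by
      intro s hs
      have h1 : HasDerivAt (fun s : ℝ => ((s * z.re : ℝ) : ℂ)) (z.re : ℂ) s := by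
        simpa using ((hasDerivAt_id s).mul_const z.re).ofReal_comp
      have h2 := HasDerivAt.comp (h₂ := time) s
        (hasDerivAt_time (region_subset_bigDomain (ofReal_mem_region (s * z.re)))) h1
      exact (Complex.reCLM.hasFDerivAt.comp_hasDerivAt s h2).const_mul z.re
    have hlt := lt_of_hasDerivAt_pos hd ?_
    · rw [one_mul, zero_mul, ← hz', h, Complex.ofReal_zero, time_zero] at hlt
      simp at hlt
    · intro s hs
      have hp := speed_re_pos (ofReal_mem_region (s * z.re))
      have e : z.re * (speed ((s * z.re : ℝ) : ℂ) * (z.re : ℂ)).re =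
          z.re ^ 2 * (speed ((s * z.re : ℝ) : ℂ)).re := by
        rw [Complex.mul_re, Complex.ofReal_re, Complex.ofReal_im]; ring
      rw [e]
      have : 0 < z.re ^ 2 := by positivity
      positivity
  rw [hz', hre, Complex.ofReal_zero]

theorem speed_ne_zero_of_mem {z : ℂ} (hz : z ∈ region) : speed z ≠ 0 := by
  intro h
  have := speed_re_pos hz
  rw [h] at this
  simp at this

theorem zero_mem_region : (0 : ℂ) ∈ region := by
  simpa using ofReal_mem_region 0

/-- The time has a holomorphic inverse on a bow tie. -/
theorem exists_inverse_time : ∃ m : ℝ, 0 < m ∧ ∃ S : ℂ → ℂ,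
    (∀ t ∈ slopedBowTie m, S t ∈ region ∧ time (S t) = t) ∧
    (∀ t ∈ slopedBowTie m, ∀ z ∈ region, time z = t → z = S t) ∧
    ∀ t ∈ slopedBowTie m, HasDerivAt S (speed (S t))⁻¹ t := by
  obtain ⟨m, hm0, hm⟩ := exists_slope
  have hstrict : ∀ z ∈ region, HasStrictDerivAt time (speed z) z :=
    fun z hz => hasStrictDerivAt_time (region_subset_bigDomain hz)
  have hex := existsUnique_preimage_of_proper isOpen_region hstrict
    (fun z hz => speed_ne_zero_of_mem hz) (isPreconnected_slopedBowTie m)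
    (time_proper hm) zero_mem_region (by rw [time_zero]; exact zero_mem_slopedBowTie m)
    (fun z hz h => eq_zero_of_time_eq_zero hz (by rw [h, time_zero]))
  choose! S hS huniq using hex
  have hu : ∀ t ∈ slopedBowTie m, ∀ z ∈ region, time z = t → z = S t :=
    fun t ht z hz h => huniq t ht z ⟨hz, h⟩
  exact ⟨m, hm0, S, hS, hu, fun t ht => hasDerivAt_of_unique_preimage isOpen_region hstrict
    (fun z hz => speed_ne_zero_of_mem hz) (isOpen_slopedBowTie m) hS hu ht⟩

/-! ### The angle and the momentum in the uniformizing variable -/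

/-- The hypothesis keeps `u` off the cuts, which run along the imaginary axis outward from `±i`. If
`(1 + iu)/(1 - iu)` were a real `k ≤ 0`, then `u² = -((k - 1)/(k + 1))² ≤ -1`. -/
theorem hasDerivAt_complex_arctan {u : ℂ} (h : ∀ j : ℝ, j ≤ -1 → u ^ 2 ≠ j) :
    HasDerivAt Complex.arctan (1 / (1 + u ^ 2)) u := by
  have hI : ∀ w : ℂ, w ^ 2 = -1 → u ≠ w := by
    intro w hw hu
    refine h (-1) le_rfl ?_
    rw [hu, hw]; simp
  have h1 : 1 + u * Complex.I ≠ 0 := by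
    intro h0
    refine hI Complex.I Complex.I_sq ?_
    linear_combination (-Complex.I) * h0 + u * Complex.I_sq
  have h2 : 1 - u * Complex.I ≠ 0 := by
    intro h0
    refine hI (-Complex.I) (by rw [neg_sq, Complex.I_sq]) ?_
    linear_combination Complex.I * h0 + u * Complex.I_sq
  have hslit : (1 + u * Complex.I) / (1 - u * Complex.I) ∈ Complex.slitPlane := by
    by_contra hc
    rw [Complex.mem_slitPlane_iff, not_or, not_lt, not_not] at hc
    obtain ⟨h3, h4⟩ := hc
    set k := ((1 + u * Complex.I) / (1 - u * Complex.I)).re with hk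
    have h5 : (1 + u * Complex.I) / (1 - u * Complex.I) = (k : ℂ) := by
      apply Complex.ext <;> simp [hk, h4]
    rw [div_eq_iff h2] at h5
    have h6 : k + 1 ≠ 0 := by
      intro h6
      have h7 : (k : ℂ) = -1 := by
        have : k = -1 := by linarith
        rw [this]; simp
      rw [h7] at h5
      have : (2 : ℂ) = 0 := by linear_combination h5
      exact two_ne_zero this
    have h6' : (k : ℂ) + 1 ≠ 0 := by
      rw [← Complex.ofReal_one, ← Complex.ofReal_add]
      exact Complex.ofReal_ne_zero.mpr h6
    refine h (-((k - 1) / (k + 1)) ^ 2) ?_ ?_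
    · rw [neg_le_neg_iff, div_pow, one_le_div (by positivity)]
      nlinarith
    · have h8 : u * Complex.I = (k - 1) / (k + 1) := by
        rw [eq_div_iff h6']
        linear_combination h5
      push_cast
      rw [← h8]
      linear_combination u ^ 2 * Complex.I_sq
  have hn : HasDerivAt (fun w : ℂ => 1 + w * Complex.I) Complex.I u := by
    simpa using ((hasDerivAt_id u).mul_const Complex.I).const_add 1
  have hd : HasDerivAt (fun w : ℂ => 1 - w * Complex.I) (-Complex.I) u := by
    simpa using ((hasDerivAt_id u).mul_const Complex.I).const_sub 1
  have hlog := ((hn.div hd h2).clog hslit).const_mul (-Complex.I / 2)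
  refine hlog.congr_deriv ?_
  have e : (1 + u ^ 2 : ℂ) = (1 + u * Complex.I) * (1 - u * Complex.I) := by
    linear_combination u ^ 2 * Complex.I_sq
  have hsum : (1 + u * Complex.I) + (1 - u * Complex.I) = 2 := by ring
  rw [e]
  simp only [Pi.div_apply]
  generalize 1 + u * Complex.I = a at *
  generalize 1 - u * Complex.I = b at *
  have hnum : Complex.I * b - a * -Complex.I = 2 * Complex.I := by
    linear_combination Complex.I * hsum
  have h9 : -Complex.I / 2 * (2 * Complex.I / b ^ 2 / (a / b)) =
      -(Complex.I * Complex.I) * (1 / (a * b)) := by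
    field_simp
  rw [hnum, h9, Complex.I_mul_I]
  ring

/-- The tangent of a quarter of the angle. -/
noncomputable def quarterTan (z : ℂ) : ℂ :=
  -- The denominator is the branch of `√(chSq z + cp)` that is positive on the real line; it is
  -- holomorphic on `region`.
  (Real.sqrt cp : ℂ) / (Complex.cosh z * csqrt (1 + cp / chSq z))

noncomputable def angle (z : ℂ) : ℂ := 4 * Complex.arctan (quarterTan z)

/-- Dictated by the first equation of motion in the form `dλ/dz = -3 Λ dt/dz`. -/
noncomputable def momentum (z : ℂ) : ℂ :=
  2 / 3 * quarterTan z * Complex.sinh (2 * z) / ((chSq z + 2 * cp) * speed z)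

theorem add_ne_zero_of_mem {z : ℂ} (hz : z ∈ region) {k : ℝ} (hk0 : 0 < k) (hk : k < 10) :
    chSq z + k ≠ 0 := by
  intro h
  have h1 : chSq z = ((-k : ℝ) : ℂ) := by push_cast; linear_combination h
  have h2 := inv_chSq_re_gt hz
  rw [h1, ← Complex.ofReal_inv, Complex.ofReal_re, inv_neg, neg_lt_neg_iff, ← one_div,
    div_lt_div_iff₀ hk0 (by norm_num)] at h2
  linarith

theorem chSq_add_cp_ne_zero {z : ℂ} (hz : z ∈ region) : chSq z + cp ≠ 0 :=
  add_ne_zero_of_mem hz cp_pos (by linarith [cp_lt])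

theorem chSq_add_cr_ne_zero {z : ℂ} (hz : z ∈ region) : chSq z + cr ≠ 0 :=
  add_ne_zero_of_mem hz cr_pos (by linarith [cr_lt])

theorem chSq_add_two_cp_ne_zero {z : ℂ} (hz : z ∈ region) : chSq z + 2 * cp ≠ 0 := by
  have := add_ne_zero_of_mem hz (k := 2 * cp) (by linarith [cp_pos]) (by linarith [cp_lt])
  push_cast at this
  exact this

theorem one_add_cp_div_mem_slitPlane {z : ℂ} (hz : z ∈ region) :
    1 + cp / chSq z ∈ Complex.slitPlane :=
  Or.inl (one_add_div_re_pos (inv_chSq_re_gt hz) cp_pos (by linarith [cp_lt]))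

theorem cosh_ne_zero_of_mem {z : ℂ} (hz : z ∈ region) : Complex.cosh z ≠ 0 := by
  intro h
  exact chSq_ne_zero_of_mem hz (by rw [chSq, h]; simp)

theorem quarterTan_ne_zero {z : ℂ} (hz : z ∈ region) : quarterTan z ≠ 0 :=
  div_ne_zero (Complex.ofReal_ne_zero.mpr (Real.sqrt_pos.mpr cp_pos).ne')
    (mul_ne_zero (cosh_ne_zero_of_mem hz) (csqrt_ne_zero _))

theorem quarterTan_sq {z : ℂ} (hz : z ∈ region) : quarterTan z ^ 2 = cp / (chSq z + cp) := by
  have h0 := chSq_ne_zero_of_mem hz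
  have h1 := chSq_add_cp_ne_zero hz
  have h2 : ((Real.sqrt cp : ℝ) : ℂ) ^ 2 = cp := by
    rw [← Complex.ofReal_pow, Real.sq_sqrt cp_pos.le]
  rw [quarterTan, div_pow, mul_pow,
    csqrt_sq (Complex.slitPlane_ne_zero (one_add_cp_div_mem_slitPlane hz)), h2,
    show Complex.cosh z ^ 2 = chSq z from rfl]
  field_simp

theorem differentiableAt_quarterTan {z : ℂ} (hz : z ∈ region) :
    DifferentiableAt ℂ quarterTan z := by
  have hd : DifferentiableAt ℂ chSq z := (hasDerivAt_chSq z).differentiableAt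
  have h2 : DifferentiableAt ℂ (fun w => csqrt (1 + cp / chSq w)) z :=
    DifferentiableAt.comp (g := csqrt) z
      (differentiableAt_csqrt (one_add_cp_div_mem_slitPlane hz))
      (((differentiableAt_const _).div hd (chSq_ne_zero_of_mem hz)).const_add 1)
  exact (differentiableAt_const _).div ((Complex.differentiable_cosh z).mul h2)
    (mul_ne_zero (cosh_ne_zero_of_mem hz) (csqrt_ne_zero _))

theorem hasDerivAt_quarterTan {z : ℂ} (hz : z ∈ region) :
    HasDerivAt quarterTan
      (-(quarterTan z * Complex.sinh (2 * z)) / (2 * (chSq z + cp))) z := by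
  have h1 := chSq_add_cp_ne_zero hz
  have hu := quarterTan_ne_zero hz
  have hd := (differentiableAt_quarterTan hz).hasDerivAt
  have hsq : HasDerivAt (fun w => quarterTan w ^ 2)
      ((0 * (chSq z + cp) - cp * Complex.sinh (2 * z)) / (chSq z + cp) ^ 2) z := by
    have hdiv : HasDerivAt (fun w => (cp : ℂ) / (chSq w + cp))
        ((0 * (chSq z + cp) - cp * Complex.sinh (2 * z)) / (chSq z + cp) ^ 2) z :=
      HasDerivAt.fun_div (hasDerivAt_const z (cp : ℂ)) ((hasDerivAt_chSq z).add_const (cp : ℂ)) h1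
    refine hdiv.congr_of_eventuallyEq ?_
    filter_upwards [isOpen_region.mem_nhds hz] with w hw
    exact quarterTan_sq hw
  have heq := (hd.pow 2).unique hsq
  have h3 := quarterTan_sq hz
  refine hd.congr_deriv ?_
  rw [eq_div_iff h1] at h3
  rw [eq_div_iff (pow_ne_zero 2 h1)] at heq
  rw [eq_div_iff (mul_ne_zero two_ne_zero h1)]
  have h4 : quarterTan z * (chSq z + cp) ≠ 0 := mul_ne_zero hu h1
  refine mul_left_cancel₀ h4 ?_
  simp only [Nat.cast_ofNat, Nat.reduceSub, pow_one] at heq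
  linear_combination heq + Complex.sinh (2 * z) * h3

theorem quarterTan_sq_ne {z : ℂ} (hz : z ∈ region) (j : ℝ) (hj : j ≤ -1) :
    quarterTan z ^ 2 ≠ j := by
  intro h
  have h0 := chSq_ne_zero_of_mem hz
  have h1 := chSq_add_cp_ne_zero hz
  rw [quarterTan_sq hz, div_eq_iff h1] at h
  have hp := cp_pos
  have h2 : (chSq z)⁻¹ = ((j / (cp * (1 - j)) : ℝ) : ℂ) := by
    have h3 : ((cp * (1 - j) : ℝ) : ℂ) ≠ 0 :=
      Complex.ofReal_ne_zero.mpr (mul_pos hp (by linarith)).ne'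
    rw [Complex.ofReal_div, eq_div_iff h3, inv_mul_eq_iff_eq_mul₀ h0]
    push_cast
    linear_combination h
  have h4 := inv_chSq_re_gt hz
  rw [h2, Complex.ofReal_re, ← neg_div, div_lt_div_iff₀ (by norm_num)
    (mul_pos hp (by linarith))] at h4
  nlinarith [cp_lt]

theorem hasDerivAt_angle {z : ℂ} (hz : z ∈ region) :
    HasDerivAt angle (-3 * momentum z * speed z) z := by
  have h1 := chSq_add_cp_ne_zero hz
  have h2 := chSq_add_two_cp_ne_zero hz
  have h3 := speed_ne_zero_of_mem hz
  have h := (HasDerivAt.comp z (hasDerivAt_complex_arctan (quarterTan_sq_ne hz))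
    (hasDerivAt_quarterTan hz)).const_mul (4 : ℂ)
  refine h.congr_deriv ?_
  rw [quarterTan_sq hz, momentum]
  have h4 : (1 + cp / (chSq z + cp) : ℂ) = (chSq z + 2 * cp) / (chSq z + cp) := by
    field_simp; ring
  rw [h4]
  field_simp
  ring

theorem differentiableAt_momentum {z : ℂ} (hz : z ∈ region) : DifferentiableAt ℂ momentum z := by
  have hd : DifferentiableAt ℂ chSq z := (hasDerivAt_chSq z).differentiableAt
  have hs : DifferentiableAt ℂ (fun w : ℂ => Complex.sinh (2 * w)) z := by fun_prop
  refine DifferentiableAt.div ?_ ?_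
    (mul_ne_zero (chSq_add_two_cp_ne_zero hz) (speed_ne_zero_of_mem hz))
  · exact ((differentiableAt_quarterTan hz).const_mul _).mul hs
  · exact (hd.add_const _).mul
      (differentiableAt_speed (offCut_of_mem (region_subset_bigDomain hz)))

/-- As a rational function of `d = chSq z`, `Λ²` has a simple pole at the collision `d = 0` and a
simple zero at the turning point `d = 1`. -/
theorem momentum_sq {z : ℂ} (hz : z ∈ region) : momentum z ^ 2 =
    14 / 3 * cp * (chSq z - 1) * (chSq z + cr) / (chSq z * (chSq z + 2 * cp) ^ 2) := by
  have h0 := chSq_ne_zero_of_mem hz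
  have h1 := chSq_add_cp_ne_zero hz
  have h2 := chSq_add_two_cp_ne_zero hz
  have h3 := chSq_add_cr_ne_zero hz
  have h4 : Complex.sinh (2 * z) ^ 2 = 4 * chSq z * (chSq z - 1) := by
    rw [Complex.sinh_two_mul, chSq]
    linear_combination 4 * Complex.cosh z ^ 2 * Complex.sinh_sq z
  rw [momentum, div_pow, mul_pow, mul_pow, mul_pow,
    speed_sq (offCut_of_mem (region_subset_bigDomain hz)), quarterTan_sq hz, h4, rate_sq_complex]
  field_simp
  ring

/-- Since `chSq z + cr` does not vanish on `region`, the momentum can vanish only if `chSq z = 1`.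
Comparing `|chSq z|` with its real part gives `Re z = 0` and `cos (2 Im z) = 1`. -/
theorem eq_zero_of_momentum_eq_zero {z : ℂ} (hz : z ∈ region) (h : momentum z = 0) : z = 0 := by
  have hm := momentum_sq hz
  have h0 := chSq_ne_zero_of_mem hz
  have h2 := chSq_add_two_cp_ne_zero hz
  have h3 := chSq_add_cr_ne_zero hz
  have hp : (cp : ℂ) ≠ 0 := Complex.ofReal_ne_zero.mpr cp_pos.ne'
  rw [h, zero_pow two_ne_zero, eq_comm, div_eq_zero_iff] at hm
  have h4 : chSq z = 1 := by
    rcases hm with hm | hm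
    · rcases mul_eq_zero.mp hm with hm | hm
      · rcases mul_eq_zero.mp hm with hm | hm
        · exact absurd hm (mul_ne_zero (by norm_num) hp)
        · linear_combination hm
      · exact absurd hm h3
    · exact absurd hm (mul_ne_zero h0 (pow_ne_zero 2 h2))
  have h5 : ‖chSq z‖ = 1 := by rw [h4, norm_one]
  have hre : (chSq z).re = 1 := by rw [h4, Complex.one_re]
  rw [norm_chSq] at h5
  rw [chSq_re] at hre
  have hc := Real.one_le_cosh (2 * z.re)
  have hcos : Real.cos (2 * z.im) = 1 := by
    have h6 : Real.cosh (2 * z.re) = 2 - Real.cos (2 * z.im) := by linarith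
    rw [h6] at hre
    have : (Real.cos (2 * z.im) - 1) ^ 2 = 0 := by linarith
    linarith [pow_eq_zero_iff (two_ne_zero) |>.mp this]
  have hx : z.re = 0 := by
    by_contra hne
    have := (Real.one_lt_cosh (x := 2 * z.re)).mpr (mul_ne_zero two_ne_zero hne)
    linarith
  have hy : |z.im| < Real.pi / 2 := by
    rcases hz with hz | hz
    · exact hz.1
    · have hz' : |z.im| < Real.pi / 12 * |z.re| := hz
      rw [hx, abs_zero, mul_zero] at hz'
      exact absurd hz' (not_lt.mpr (abs_nonneg _))
  rw [abs_lt] at hy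
  have h7 : 2 * z.im = 0 := (Real.cos_eq_one_iff_of_lt_of_lt (by linarith) (by linarith)).mp hcos
  apply Complex.ext
  · simpa using hx
  · simp; linarith

theorem momentum_zero : momentum 0 = 0 := by simp [momentum]

/-! ### Behaviour at the singularity -/

theorem mul_I_mem_region {y : ℝ} (h0 : 0 ≤ y) (h1 : y < Real.pi / 2) :
    (y * Complex.I : ℂ) ∈ region := by
  have hc : 0 < Real.cos y := Real.cos_pos_of_mem_Ioo ⟨by linarith [Real.pi_pos], h1⟩
  left
  refine ⟨by simpa [abs_of_nonneg h0] using h1, ?_⟩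
  simp [Real.cos_two_mul]
  positivity

/-- The momentum blows up at the top of the strip. -/
theorem tendsto_norm_momentum :
    Tendsto (fun y : ℝ => ‖momentum (y * Complex.I) ^ 2‖) (𝓝[<] (Real.pi / 2)) atTop := by
  have hpi := Real.pi_pos
  have hp : (cp : ℂ) ≠ 0 := Complex.ofReal_ne_zero.mpr cp_pos.ne'
  have hr : (cr : ℂ) ≠ 0 := Complex.ofReal_ne_zero.mpr cr_pos.ne'
  have hd : Tendsto (fun y : ℝ => ((Real.cos y ^ 2 : ℝ) : ℂ)) (𝓝[<] (Real.pi / 2)) (𝓝[≠] 0) := by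
    rw [tendsto_nhdsWithin_iff]
    constructor
    · have hc : Continuous fun y : ℝ => ((Real.cos y ^ 2 : ℝ) : ℂ) := by fun_prop
      have := hc.tendsto (Real.pi / 2)
      simp only [Real.cos_pi_div_two] at this
      simpa using this.mono_left nhdsWithin_le_nhds
    · have h1 : ∀ᶠ y in 𝓝[<] (Real.pi / 2), y ∈ Set.Ioo 0 (Real.pi / 2) :=
        Ioo_mem_nhdsLT (by linarith)
      filter_upwards [h1] with y hy
      have : 0 < Real.cos y := Real.cos_pos_of_mem_Ioo ⟨by linarith [hy.1], hy.2⟩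
      exact Complex.ofReal_ne_zero.mpr (by positivity)
  have hnum : Tendsto (fun d : ℂ => ‖14 / 3 * cp * (d - 1) * (d + cr) / (d + 2 * cp) ^ 2‖)
      (𝓝[≠] 0) (𝓝 ‖14 / 3 * cp * ((0 : ℂ) - 1) * (0 + cr) / (0 + 2 * cp) ^ 2‖) := by
    have hc : ContinuousAt (fun d : ℂ => 14 / 3 * cp * (d - 1) * (d + cr) / (d + 2 * cp) ^ 2) 0 := by
      refine ContinuousAt.div (by fun_prop) (by fun_prop) ?_
      exact pow_ne_zero 2 (by rw [zero_add]; exact mul_ne_zero two_ne_zero hp)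
    exact (hc.norm.tendsto).mono_left nhdsWithin_le_nhds
  have hpos : 0 < ‖14 / 3 * cp * ((0 : ℂ) - 1) * (0 + cr) / (0 + 2 * cp) ^ 2‖ := by
    rw [norm_pos_iff]
    refine div_ne_zero (mul_ne_zero (mul_ne_zero (mul_ne_zero (by norm_num) hp) (by norm_num)) ?_) ?_
    · rwa [zero_add]
    · exact pow_ne_zero 2 (by rw [zero_add]; exact mul_ne_zero two_ne_zero hp)
  have hinv : Tendsto (fun d : ℂ => ‖d⁻¹‖) (𝓝[≠] 0) atTop :=
    (tendsto_norm_inv_nhdsNE_zero_atTop (α := ℂ)).congr fun d => by rw [norm_inv]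
  have hprod := (hnum.pos_mul_atTop hpos hinv).comp hd
  refine hprod.congr' ?_
  filter_upwards [Ioo_mem_nhdsLT (by linarith : 0 < Real.pi / 2)] with y hy
  have hmem := mul_I_mem_region hy.1.le hy.2
  rw [momentum_sq hmem, chSq_ofReal_mul_I]
  simp only [Function.comp]
  rw [← norm_mul]
  congr 1
  generalize ((Real.cos y ^ 2 : ℝ) : ℂ) = d
  rw [mul_comm d, ← div_div, div_eq_mul_inv (_ / _) d]

/-! ### The real differential equation -/

theorem four_mul_sq_rpow {q : ℝ} (hq : 0 < q) : (4 * q ^ 2) ^ (3 / 2 : ℝ) = 8 * q ^ 3 := by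
  have h : 4 * q ^ 2 = (2 * q) ^ (2 : ℝ) := by
    rw [Real.rpow_two]; ring
  rw [h, ← Real.rpow_mul (by positivity)]
  norm_num
  ring

theorem two_add_two_cos (l : ℝ) : 2 + 2 * Real.cos l = 4 * Real.cos (l / 2) ^ 2 := by
  rw [Real.cos_sq, mul_div_cancel₀ _ (two_ne_zero' ℝ)]; ring

theorem field_snd {p : ℝ × ℝ} (h : 0 < Real.cos (p.1 / 2)) : (field p).2 =
    Real.sin (p.1 / 2) * (-2 * Real.cos (p.1 / 2) + 1 / (4 * Real.cos (p.1 / 2) ^ 2)) := by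
  have hs : Real.sin p.1 = 2 * Real.sin (p.1 / 2) * Real.cos (p.1 / 2) := by
    rw [← Real.sin_two_mul, mul_div_cancel₀ _ (two_ne_zero' ℝ)]
  simp only [field]
  rw [two_add_two_cos, four_mul_sq_rpow h, hs]
  field_simp
  ring

theorem cos_half_pos {l : ℝ} (h : l ∈ Set.Ioo (-Real.pi) Real.pi) : 0 < Real.cos (l / 2) :=
  Real.cos_pos_of_mem_Ioo ⟨by linarith [h.1], by linarith [h.2]⟩

/-- The Hamiltonian, up to sign and an additive constant. -/
noncomputable def energy (p : ℝ × ℝ) : ℝ :=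
  3 / 2 * p.2 ^ 2 + 2 * Real.cos (p.1 / 2) ^ 2 + 1 / (2 * Real.cos (p.1 / 2))

/-- Only the first equation of motion is assumed. The defect in the second appears multiplied by
`3L`, so energy conservation recovers that equation wherever `L ≠ 0`. -/
theorem hasDerivAt_energy {l L : ℝ → ℝ} {L' t : ℝ} (hl : HasDerivAt l (-3 * L t) t)
    (hL : HasDerivAt L L' t) (hmem : l t ∈ Set.Ioo (-Real.pi) Real.pi) :
    HasDerivAt (fun s => energy (l s, L s)) (3 * L t * (L' - (field (l t, L t)).2)) t := by
  have hq := cos_half_pos hmem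
  have hc := (Real.hasDerivAt_cos (l t / 2)).comp t (hl.div_const 2)
  have h1 := (hL.pow 2).const_mul (3 / 2 : ℝ)
  have h2 := (hc.pow 2).const_mul (2 : ℝ)
  have h3 := (hasDerivAt_const t (1 : ℝ)).div (hc.const_mul 2) (by simpa using hq.ne')
  refine ((h1.add h2).add h3).congr_deriv ?_
  rw [field_snd (p := (l t, L t)) hq]
  simp only [Function.comp, Nat.cast_ofNat, Nat.reduceSub, pow_one]
  field_simp
  ring

theorem contDiffAt_field {p : ℝ × ℝ} (h : Real.cos p.1 ≠ -1) : ContDiffAt ℝ 1 field p := by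
  have h1 : 0 < 2 + 2 * Real.cos p.1 := by
    have := lt_of_le_of_ne (Real.neg_one_le_cos p.1) (Ne.symm h)
    linarith
  have hfst : ContDiffAt ℝ 1 (fun q : ℝ × ℝ => q.1) p := contDiffAt_fst
  have hsnd : ContDiffAt ℝ 1 (fun q : ℝ × ℝ => q.2) p := contDiffAt_snd
  have hb : ContDiffAt ℝ 1 (fun q : ℝ × ℝ => 2 + 2 * Real.cos q.1) p :=
    contDiffAt_const.add (contDiffAt_const.mul hfst.cos)
  have hr : ContDiffAt ℝ 1 (fun q : ℝ × ℝ => (2 + 2 * Real.cos q.1) ^ (3 / 2 : ℝ)) p :=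
    hb.rpow_const_of_ne h1.ne'
  refine (contDiffAt_const.mul hsnd).prodMk (hfst.sin.neg.mul ?_)
  exact contDiffAt_const.sub (contDiffAt_const.div hr (Real.rpow_pos_of_pos h1 _).ne')

/-- The set where the solutions agree is closed, and it is open by local uniqueness, as the field is
`C¹` away from collisions. -/
theorem solution_unique {f g : ℝ → ℝ × ℝ} (hf : ∀ t, HasDerivAt f (field (f t)) t)
    (hg : ∀ t, HasDerivAt g (field (g t)) t) (hc : ∀ t, Real.cos (f t).1 ≠ -1)
    (h0 : f 0 = g 0) : f = g := by
  have hfc : Continuous f := continuous_iff_continuousAt.mpr fun t => (hf t).continuousAt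
  have hgc : Continuous g := continuous_iff_continuousAt.mpr fun t => (hg t).continuousAt
  have hclopen : IsClopen {t | f t = g t} := by
    refine ⟨isClosed_eq hfc hgc, ?_⟩
    rw [isOpen_iff_mem_nhds]
    intro t (ht : f t = g t)
    obtain ⟨K, s, hs, hl⟩ := (contDiffAt_field (hc t)).exists_lipschitzOnWith
    refine ODE_solution_unique_of_eventually (v := fun _ => field) (s := fun _ => s)
      (Eventually.of_forall fun _ => hl) ?_ ?_ ht
    · filter_upwards [hfc.continuousAt.eventually_mem hs] with x hx
      exact ⟨hf x, hx⟩
    · rw [ht] at hs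
      filter_upwards [hgc.continuousAt.eventually_mem hs] with x hx
      exact ⟨hg x, hx⟩
  have huniv := hclopen.eq_univ ⟨0, h0⟩
  ext1 t
  exact Set.eq_univ_iff_forall.mp huniv t

namespace IsSeparatrix

variable {σ : ℝ → ℝ × ℝ}

theorem continuous (hσ : IsSeparatrix σ) : Continuous σ :=
  continuous_iff_continuousAt.mpr fun t => (hσ.isSolution t).continuousAt

/-- The lifted angle starts in `(0, π)` and cannot cross the collision values `±π`. -/
theorem angle_mem (hσ : IsSeparatrix σ) (t : ℝ) : (σ t).1 ∈ Set.Ioo (-Real.pi) Real.pi := by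
  have hc : Continuous fun s => (σ s).1 := continuous_fst.comp hσ.continuous
  have hpi := Real.pi_pos
  have h0 := hσ.angle_zero_mem
  have hpre : IsPreconnected (Set.range fun s => (σ s).1) := isPreconnected_range hc
  have hord := hpre.ordConnected
  constructor
  · by_contra h
    rw [not_lt] at h
    have : -Real.pi ∈ Set.range fun s => (σ s).1 :=
      hord.out ⟨t, rfl⟩ ⟨0, rfl⟩ ⟨h, by linarith [h0.1]⟩
    obtain ⟨s, hs⟩ := this
    refine hσ.noCollision s ?_
    simp only at hs
    rw [hs, Real.cos_neg, Real.cos_pi]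
  · by_contra h
    rw [not_lt] at h
    have : Real.pi ∈ Set.range fun s => (σ s).1 :=
      hord.out ⟨0, rfl⟩ ⟨t, rfl⟩ ⟨h0.2.le, h⟩
    obtain ⟨s, hs⟩ := this
    refine hσ.noCollision s ?_
    simp only at hs
    rw [hs, Real.cos_pi]

/-- Energy is conserved, and its value is read off from the limit at the saddle. -/
theorem energy_eq (hσ : IsSeparatrix σ) (t : ℝ) : energy (σ t) = 5 / 2 := by
  have hd : ∀ s, HasDerivAt (fun s => energy (σ s)) 0 s := by
    intro s
    have h1 : HasDerivAt (fun s => (σ s).1) (-3 * (σ s).2) s := (hσ.isSolution s).fst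
    have h2 : HasDerivAt (fun s => (σ s).2) (field (σ s)).2 s := (hσ.isSolution s).snd
    have := hasDerivAt_energy h1 h2 (hσ.angle_mem s)
    simpa using this
  have hconst : ∀ s, energy (σ s) = energy (σ t) := fun s =>
    is_const_of_deriv_eq_zero (fun x => (hd x).differentiableAt) (fun x => (hd x).deriv) s t
  have hcont : ContinuousAt energy (0, 0) := by
    have h1 : Continuous fun p : ℝ × ℝ => 3 / 2 * p.2 ^ 2 + 2 * Real.cos (p.1 / 2) ^ 2 := by
      fun_prop
    have h2 : ContinuousAt (fun p : ℝ × ℝ => 1 / (2 * Real.cos (p.1 / 2))) (0, 0) := by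
      refine continuousAt_const.div (by fun_prop) (by simp)
    exact h1.continuousAt.add h2
  have hlim : Tendsto (fun s => energy (σ s)) atTop (𝓝 (energy (0, 0))) :=
    hcont.tendsto.comp hσ.tendsto_atTop
  have h3 : energy (0, 0) = 5 / 2 := by simp [energy]; norm_num
  rw [h3] at hlim
  refine tendsto_nhds_unique ?_ hlim
  exact tendsto_const_nhds.congr fun s => (hconst s).symm

/-- At zero momentum the energy equation factors as `(q - 1)(4q² + 4q - 1) = 0`. The bound `λ₀ >
2π/3` excludes `q = 1`, and `q > 0` selects the root. -/
theorem cos_half_zero (hσ : IsSeparatrix σ) :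
    Real.cos ((σ 0).1 / 2) = 1 / (2 * cp + 1) := by
  have he := hσ.energy_eq 0
  have hp := cp_pos
  have h0 := hσ.angle_zero_mem
  have hpi := Real.pi_pos
  have hq := cos_half_pos (hσ.angle_mem 0)
  have hlt : Real.cos ((σ 0).1 / 2) < 1 / 2 := by
    rw [← Real.cos_pi_div_three]
    exact Real.cos_lt_cos_of_nonneg_of_le_pi (by linarith) (by linarith [h0.2])
      (by linarith [h0.1])
  rw [energy, hσ.momentum_zero] at he
  set q := Real.cos ((σ 0).1 / 2) with hqdef
  have h1 : (q - 1) * (4 * q ^ 2 + 4 * q - 1) = 0 := by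
    field_simp at he
    linear_combination he
  have h2 : 4 * q ^ 2 + 4 * q - 1 = 0 := (mul_eq_zero.mp h1).resolve_left (by linarith)
  set k := 1 / (2 * cp + 1) with hk
  have hk0 : 0 < k := by positivity
  have hk2 : 4 * k ^ 2 + 4 * k - 1 = 0 := by
    rw [hk]
    field_simp
    linear_combination (-1) * cp_quadratic
  have h3 : (q - k) * (4 * (q + k + 1)) = 0 := by linear_combination h2 - hk2
  have h4 := (mul_eq_zero.mp h3).resolve_right (by positivity)
  linarith

end IsSeparatrix

/-! ### Real values of the uniformized separatrix -/

/-- The restriction of `quarterTan` to the real line. -/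
noncomputable def realTan (x : ℝ) : ℝ :=
  Real.sqrt cp / (Real.cosh x * Real.sqrt (1 + cp / Real.cosh x ^ 2))

theorem realTan_pos (x : ℝ) : 0 < realTan x := by
  have := cp_pos
  have := Real.cosh_pos x
  unfold realTan
  positivity

theorem realTan_sq (x : ℝ) : realTan x ^ 2 = cp / (Real.cosh x ^ 2 + cp) := by
  have hp := cp_pos
  have hc := Real.cosh_pos x
  rw [realTan, div_pow, mul_pow, Real.sq_sqrt hp.le, Real.sq_sqrt (by positivity)]
  field_simp

theorem quarterTan_ofReal (x : ℝ) : quarterTan x = realTan x := by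
  have hp := cp_pos
  have hc := Real.cosh_pos x
  have h : 0 < 1 + cp / Real.cosh x ^ 2 := by positivity
  have e : (1 + (cp : ℂ) / ((Real.cosh x ^ 2 : ℝ) : ℂ)) = ((1 + cp / Real.cosh x ^ 2 : ℝ) : ℂ) := by
    rw [Complex.ofReal_add, Complex.ofReal_div, Complex.ofReal_one]
  rw [quarterTan, chSq_ofReal, e, csqrt_ofReal h, realTan, Complex.ofReal_div, Complex.ofReal_mul,
    Complex.ofReal_cosh]

theorem angle_ofReal (x : ℝ) : angle x = ((4 * Real.arctan (realTan x) : ℝ) : ℂ) := by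
  rw [angle, quarterTan_ofReal, ← Complex.ofReal_arctan]
  push_cast
  rfl

theorem realAngle_mem (x : ℝ) : 4 * Real.arctan (realTan x) ∈ Set.Ioo 0 Real.pi := by
  have hp := cp_pos
  have h0 := realTan_pos x
  have h1 : realTan x < 1 := by
    have hD : 1 ≤ Real.cosh x ^ 2 := one_le_pow₀ (Real.one_le_cosh x)
    have h2 : realTan x ^ 2 < 1 := by
      rw [realTan_sq, div_lt_one (by positivity)]; linarith
    nlinarith
  have h2 := Real.arctan_pos.mpr h0
  have h3 := Real.arctan_strictMono h1
  rw [Real.arctan_one] at h3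
  exact ⟨by linarith, by linarith⟩

theorem cos_half_realAngle (x : ℝ) : Real.cos (4 * Real.arctan (realTan x) / 2) =
    Real.cosh x ^ 2 / (Real.cosh x ^ 2 + 2 * cp) := by
  have hp := cp_pos
  have hc := Real.cosh_pos x
  have e : 4 * Real.arctan (realTan x) / 2 = 2 * Real.arctan (realTan x) := by ring
  rw [e, Real.cos_two_mul, Real.cos_sq_arctan, realTan_sq]
  field_simp
  ring

theorem speed_ofReal (x : ℝ) : speed x = ((speed x).re : ℂ) := by
  have h := speed_conj (offCut_of_mem (region_subset_bigDomain (ofReal_mem_region x)))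
  rw [Complex.conj_ofReal] at h
  exact (Complex.conj_eq_iff_re.mp h.symm).symm

theorem momentum_ofReal (x : ℝ) : momentum x = ((momentum x).re : ℂ) := by
  have h : ∃ r : ℝ, momentum x = r := by
    refine ⟨2 / 3 * realTan x * Real.sinh (2 * x) /
      ((Real.cosh x ^ 2 + 2 * cp) * (speed x).re), ?_⟩
    rw [momentum, quarterTan_ofReal, speed_ofReal x, chSq_ofReal]
    push_cast
    simp only [Complex.ofReal_re]
  obtain ⟨r, hr⟩ := h
  rw [hr, Complex.ofReal_re]

theorem momentum_ofReal_re_sq (x : ℝ) : (momentum x).re ^ 2 =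
    14 / 3 * cp * (Real.cosh x ^ 2 - 1) * (Real.cosh x ^ 2 + cr) /
      (Real.cosh x ^ 2 * (Real.cosh x ^ 2 + 2 * cp) ^ 2) := by
  have h := momentum_sq (ofReal_mem_region x)
  rw [momentum_ofReal x, chSq_ofReal] at h
  apply Complex.ofReal_injective
  push_cast at h ⊢
  exact h

theorem energy_ofReal (x : ℝ) :
    energy (4 * Real.arctan (realTan x), (momentum x).re) = 5 / 2 := by
  have hp := cp_pos
  have hc : 0 < Real.cosh x ^ 2 := pow_pos (Real.cosh_pos x) 2
  simp only [energy]
  rw [cos_half_realAngle, momentum_ofReal_re_sq, cr]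
  generalize Real.cosh x ^ 2 = D at *
  field_simp
  linear_combination 14 * cp * cp_quadratic

/-! ### Reality and the differential equation -/

theorem conj_mem_region {z : ℂ} (hz : z ∈ region) : (starRingEnd ℂ) z ∈ region := by
  rcases hz with ⟨h1, h2⟩ | hz
  · left
    refine ⟨by simpa using h1, ?_⟩
    simpa using h2
  · right
    have hz' : |z.im| < Real.pi / 12 * |z.re| := hz
    simpa using hz'

theorem neg_mem_region {z : ℂ} (hz : z ∈ region) : -z ∈ region := by
  rcases hz with ⟨h1, h2⟩ | hz
  · left
    refine ⟨by simpa using h1, ?_⟩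
    simpa using h2
  · right
    have hz' : |z.im| < Real.pi / 12 * |z.re| := hz
    simpa using hz'

theorem ofReal_mem_slopedBowTie {m : ℝ} (hm : 0 ≤ m) (t : ℝ) : (t : ℂ) ∈ slopedBowTie m := by
  change |(t : ℂ).im| < m * |(t : ℂ).re| + height
  have := height_pos
  simp only [Complex.ofReal_im, abs_zero, Complex.ofReal_re]
  positivity

section

variable {m : ℝ} {S : ℂ → ℂ}

theorem hasDerivAt_angle_comp (hS : ∀ t ∈ slopedBowTie m, S t ∈ region ∧ time (S t) = t)
    (hd : ∀ t ∈ slopedBowTie m, HasDerivAt S (speed (S t))⁻¹ t) {t : ℂ}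
    (ht : t ∈ slopedBowTie m) :
    HasDerivAt (fun w => angle (S w)) (-3 * momentum (S t)) t := by
  have h1 := (hS t ht).1
  have h2 := speed_ne_zero_of_mem h1
  refine (HasDerivAt.comp t (hasDerivAt_angle h1) (hd t ht)).congr_deriv ?_
  field_simp

theorem differentiableOn_momentum_comp
    (hS : ∀ t ∈ slopedBowTie m, S t ∈ region ∧ time (S t) = t)
    (hd : ∀ t ∈ slopedBowTie m, HasDerivAt S (speed (S t))⁻¹ t) :
    DifferentiableOn ℂ (fun w => momentum (S w)) (slopedBowTie m) := fun t ht =>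
  (DifferentiableAt.comp (g := momentum) t (differentiableAt_momentum (hS t ht).1)
    (hd t ht).differentiableAt).differentiableWithinAt

theorem inverse_zero (huniq : ∀ t ∈ slopedBowTie m, ∀ z ∈ region, time z = t → z = S t) :
    S 0 = 0 :=
  (huniq 0 (zero_mem_slopedBowTie m) 0 zero_mem_region time_zero).symm

theorem inverse_ofReal (hm : 0 ≤ m)
    (hS : ∀ t ∈ slopedBowTie m, S t ∈ region ∧ time (S t) = t)
    (huniq : ∀ t ∈ slopedBowTie m, ∀ z ∈ region, time z = t → z = S t) (t : ℝ) :
    S t = ((S t).re : ℂ) := by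
  have ht := ofReal_mem_slopedBowTie hm t
  obtain ⟨h1, h2⟩ := hS t ht
  have h3 := huniq t ht _ (conj_mem_region h1) (by
    rw [time_conj (region_subset_bigDomain h1), h2, Complex.conj_ofReal])
  exact (Complex.conj_eq_iff_re.mp h3).symm

/-- The first equation is the chain rule. The second follows from constant energy for `t ≠ 0`, where
the momentum does not vanish, and extends to `t = 0` by continuity. -/
theorem solves_field (hm : 0 ≤ m)
    (hS : ∀ t ∈ slopedBowTie m, S t ∈ region ∧ time (S t) = t)
    (huniq : ∀ t ∈ slopedBowTie m, ∀ z ∈ region, time z = t → z = S t)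
    (hd : ∀ t ∈ slopedBowTie m, HasDerivAt S (speed (S t))⁻¹ t) (t : ℝ) :
    HasDerivAt (fun t : ℝ => ((angle (S t)).re, (momentum (S t)).re))
      (field ((angle (S t)).re, (momentum (S t)).re)) t := by
  have hreal := inverse_ofReal hm hS huniq
  have hW := ofReal_mem_slopedBowTie hm
  have hang : ∀ t : ℝ, (angle (S t)).re = 4 * Real.arctan (realTan (S t).re) := fun t => by
    rw [hreal t, angle_ofReal, Complex.ofReal_re, Complex.ofReal_re]
  have hl : ∀ t : ℝ, HasDerivAt (fun t : ℝ => (angle (S t)).re) (-3 * (momentum (S t)).re) t := by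
    intro t
    have := (hasDerivAt_angle_comp hS hd (hW t)).real_of_complex
    refine this.congr_deriv ?_
    simp
  have hdiff := differentiableOn_momentum_comp hS hd
  have hopen := isOpen_slopedBowTie m
  have hL : ∀ t : ℝ, HasDerivAt (fun t : ℝ => (momentum (S t)).re)
      (deriv (fun w => momentum (S w)) t).re t := fun t =>
    (hdiff.differentiableAt (hopen.mem_nhds (hW t))).hasDerivAt.real_of_complex
  have hmem : ∀ t : ℝ, (angle (S t)).re ∈ Set.Ioo (-Real.pi) Real.pi := fun t => by
    have h := realAngle_mem (S t).re
    rw [hang]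
    exact ⟨by linarith [h.1, Real.pi_pos], h.2⟩
  have henergy : ∀ t : ℝ, energy ((angle (S t)).re, (momentum (S t)).re) = 5 / 2 := fun t => by
    have := energy_ofReal (S t).re
    rwa [← hang, ← hreal t] at this
  have hprod : ∀ t : ℝ, t ≠ 0 → (deriv (fun w => momentum (S w)) t).re =
      (field ((angle (S t)).re, (momentum (S t)).re)).2 := by
    intro t ht
    have h1 := hasDerivAt_energy (hl t) (hL t) (hmem t)
    have h2 : HasDerivAt (fun s : ℝ => energy ((angle (S s)).re, (momentum (S s)).re)) 0 t := by
      simp only [henergy]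
      exact hasDerivAt_const t _
    have h3 := h1.unique h2
    have h4 : (momentum (S t)).re ≠ 0 := by
      intro h0
      have h5 : momentum (S t) = 0 := by
        rw [hreal t, momentum_ofReal, ← hreal t, h0, Complex.ofReal_zero]
      have h6 := eq_zero_of_momentum_eq_zero (hS t (hW t)).1 h5
      have h7 := (hS t (hW t)).2
      rw [h6, time_zero] at h7
      exact ht (by exact_mod_cast h7.symm)
    have h5 := (mul_eq_zero.mp h3).resolve_left (by simpa using h4)
    linarith
  have hc1 : Continuous fun t : ℝ => (deriv (fun w => momentum (S w)) t).re := by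
    have h1 : ContinuousOn (deriv (fun w => momentum (S w))) (slopedBowTie m) :=
      (hdiff.deriv hopen).continuousOn
    exact Complex.continuous_re.comp (h1.comp_continuous Complex.continuous_ofReal hW)
  have hc2 : Continuous fun t : ℝ => (field ((angle (S t)).re, (momentum (S t)).re)).2 := by
    rw [continuous_iff_continuousAt]
    intro t
    have hcos : Real.cos (angle (S t)).re ≠ -1 := by
      have h1 := two_add_two_cos (angle (S t)).re
      have h2 := cos_half_pos (hmem t)
      intro h
      rw [h] at h1
      have : 0 < 4 * Real.cos ((angle (S t)).re / 2) ^ 2 := by positivity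
      linarith
    have h1 : ContinuousAt field ((angle (S t)).re, (momentum (S t)).re) :=
      (contDiffAt_field hcos).continuousAt
    have h2 : ContinuousAt (fun t : ℝ => ((angle (S t)).re, (momentum (S t)).re)) t :=
      (hl t).continuousAt.prodMk (hL t).continuousAt
    exact continuousAt_snd.comp (ContinuousAt.comp (g := field) h1 h2)
  have hall : (fun t : ℝ => (deriv (fun w => momentum (S w)) t).re) =
      fun t : ℝ => (field ((angle (S t)).re, (momentum (S t)).re)).2 :=
    Continuous.ext_on (dense_compl_singleton (0 : ℝ)) hc1 hc2 fun t ht => hprod t ht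
  have h2 := hL t
  rw [congrFun hall t] at h2
  exact (hl t).prodMk h2

theorem eq_of_isSeparatrix {σ : ℝ → ℝ × ℝ} (hσ : IsSeparatrix σ) (hm : 0 ≤ m)
    (hS : ∀ t ∈ slopedBowTie m, S t ∈ region ∧ time (S t) = t)
    (huniq : ∀ t ∈ slopedBowTie m, ∀ z ∈ region, time z = t → z = S t)
    (hd : ∀ t ∈ slopedBowTie m, HasDerivAt S (speed (S t))⁻¹ t) (t : ℝ) :
    (angle (S t), momentum (S t)) = (((σ t).1 : ℂ), ((σ t).2 : ℂ)) := by
  have h0 : σ 0 = ((angle (S (0 : ℝ))).re, (momentum (S (0 : ℝ))).re) := by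
    have hz : S ((0 : ℝ) : ℂ) = ((0 : ℝ) : ℂ) := by
      rw [Complex.ofReal_zero]; exact inverse_zero huniq
    rw [hz, angle_ofReal, Complex.ofReal_re, Complex.ofReal_zero, momentum_zero, Complex.zero_re]
    apply Prod.ext
    · have h1 := hσ.cos_half_zero
      have h2 := cos_half_realAngle 0
      rw [Real.cosh_zero, one_pow, add_comm (1 : ℝ)] at h2
      have h3 := hσ.angle_zero_mem
      have h4 := realAngle_mem 0
      have hpi := Real.pi_pos
      have := Real.injOn_cos ⟨by linarith [h3.1], by linarith [h3.2]⟩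
        ⟨by linarith [h4.1], by linarith [h4.2]⟩ (h1.trans h2.symm)
      simp only
      linarith
    · exact hσ.momentum_zero
  have heq := solution_unique hσ.isSolution (solves_field hm hS huniq hd) hσ.noCollision h0
  have hreal := inverse_ofReal hm hS huniq t
  rw [heq]
  apply Prod.ext
  · simp only
    rw [hreal, angle_ofReal, Complex.ofReal_re]
  · simp only
    rw [hreal]
    exact momentum_ofReal _

/-! ### The two singularities -/

theorem time_mul_I_mem {y : ℝ} (hy : y ∈ Set.Ioo 0 (Real.pi / 2)) (k : ℝ) :
    time (y * Complex.I) ∈ slopedBowTie k := by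
  have h1 := integral_axisSpeed_lt (y := y) (by linarith [hy.1, Real.pi_pos]) hy.2
  have h2 : 0 ≤ ∫ s in (0 : ℝ)..y, axisSpeed s :=
    intervalIntegral.integral_nonneg hy.1.le fun s _ => axisSpeed_nonneg s
  change |(time (y * Complex.I)).im| < k * |(time (y * Complex.I)).re| + height
  rw [time_mul_I, Complex.im_ofReal_mul, Complex.re_ofReal_mul, Complex.I_im, Complex.I_re,
    mul_one, mul_zero, abs_zero, mul_zero, zero_add, abs_of_nonneg h2]
  exact h1

theorem neg_mem_slopedBowTie {k : ℝ} {t : ℂ} (ht : t ∈ slopedBowTie k) : -t ∈ slopedBowTie k := by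
  have h : |t.im| < k * |t.re| + height := ht
  change |(-t).im| < k * |(-t).re| + height
  simpa using h

theorem tendsto_time_mul_I :
    Tendsto (fun y : ℝ => time (y * Complex.I)) (𝓝[<] (Real.pi / 2)) (𝓝 (height * Complex.I)) := by
  have hmem : ((Real.pi / 2 : ℝ) * Complex.I : ℂ) ∈ bigDomain := by
    left; right
    have hpi := Real.pi_pos
    have hpi' := Real.pi_lt_d2
    refine ⟨by simp, ?_⟩
    rw [Complex.im_ofReal_mul, Complex.I_im, mul_one, abs_of_pos (by linarith)]
    linarith
  have h1 := (hasDerivAt_time hmem).continuousAt.tendsto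
  rw [time_pi_div_two] at h1
  have h2 : Continuous fun y : ℝ => (y * Complex.I : ℂ) := by fun_prop
  exact (h1.comp (h2.tendsto (Real.pi / 2))).mono_left nhdsWithin_le_nhds

/-- Each of the two singularities is reached along a path on which the momentum blows up. -/
theorem exists_path {k : ℝ} (hkm : slopedBowTie k ⊆ slopedBowTie m)
    (huniq : ∀ t ∈ slopedBowTie m, ∀ z ∈ region, time z = t → z = S t) {e : ℂ}
    (he : e = height * Complex.I ∨ e = -(height * Complex.I)) :
    ∃ γ : ℝ → ℂ, Tendsto γ (𝓝[<] (Real.pi / 2)) (𝓝[slopedBowTie k] e) ∧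
      Tendsto (fun y => ‖momentum (S (γ y)) ^ 2‖) (𝓝[<] (Real.pi / 2)) atTop := by
  have hev : ∀ᶠ y in 𝓝[<] (Real.pi / 2), y ∈ Set.Ioo 0 (Real.pi / 2) :=
    Ioo_mem_nhdsLT (by linarith [Real.pi_pos])
  rcases he with rfl | rfl
  · refine ⟨fun y => time (y * Complex.I), tendsto_nhdsWithin_iff.mpr ⟨tendsto_time_mul_I, ?_⟩, ?_⟩
    · filter_upwards [hev] with y hy
      exact time_mul_I_mem hy k
    · refine tendsto_norm_momentum.congr' ?_
      filter_upwards [hev] with y hy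
      rw [← huniq _ (hkm (time_mul_I_mem hy k)) _ (mul_I_mem_region hy.1.le hy.2) rfl]
  · refine ⟨fun y => -time (y * Complex.I),
      tendsto_nhdsWithin_iff.mpr ⟨tendsto_time_mul_I.neg, ?_⟩, ?_⟩
    · filter_upwards [hev] with y hy
      exact neg_mem_slopedBowTie (time_mul_I_mem hy k)
    · refine tendsto_norm_momentum.congr' ?_
      filter_upwards [hev] with y hy
      have hmem := mul_I_mem_region hy.1.le hy.2
      rw [← huniq _ (hkm (neg_mem_slopedBowTie (time_mul_I_mem hy k))) _ (neg_mem_region hmem)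
        (time_neg _), momentum_sq hmem, momentum_sq (neg_mem_region hmem), chSq_neg]

end

/-! ### The bow tie -/

theorem bowTie_eq {β : ℝ} (hβ : 0 ≤ Real.tan β) :
    bowTie height β = slopedBowTie (Real.tan β) := by
  ext t
  constructor
  · rintro (h | h)
    · have h' : |t.im| < Real.tan β * t.re + height := h
      change |t.im| < Real.tan β * |t.re| + height
      linarith [mul_le_mul_of_nonneg_left (le_abs_self t.re) hβ]
    · have h' : |t.im| < -Real.tan β * t.re + height := h
      change |t.im| < Real.tan β * |t.re| + height
      linarith [mul_le_mul_of_nonneg_left (neg_abs_le t.re) hβ]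
  · intro h
    have h' : |t.im| < Real.tan β * |t.re| + height := h
    rcases abs_cases t.re with ⟨h1, -⟩ | ⟨h1, -⟩
    · left
      change |t.im| < Real.tan β * t.re + height
      rwa [h1] at h'
    · right
      change |t.im| < -Real.tan β * t.re + height
      rw [h1] at h'
      linarith

/-- Off the imaginary axis the larger slope makes the inequality strict; on the axis only the two
corners can fail. -/
theorem closure_slopedBowTie_subset {k m : ℝ} (hkm : k < m) {z : ℂ}
    (hz : z ∈ closure (slopedBowTie k)) :
    z ∈ slopedBowTie m ∨ z = height * Complex.I ∨ z = -(height * Complex.I) := by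
  have hcl : IsClosed {t : ℂ | |t.im| ≤ k * |t.re| + height} :=
    isClosed_le Complex.continuous_im.abs
      ((continuous_const.mul Complex.continuous_re.abs).add continuous_const)
  have hsub : slopedBowTie k ⊆ {t : ℂ | |t.im| ≤ k * |t.re| + height} :=
    Set.ofPred_subset_ofPred.mpr fun t ht => le_of_lt ht
  have h : |z.im| ≤ k * |z.re| + height := closure_minimal hsub hcl hz
  by_cases hre : z.re = 0
  · rw [hre, abs_zero, mul_zero, zero_add] at h
    rcases h.lt_or_eq with h1 | h1
    · left
      change |z.im| < m * |z.re| + height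
      rw [hre, abs_zero, mul_zero, zero_add]
      exact h1
    · right
      rcases abs_eq height_pos.le |>.mp h1 with h2 | h2
      · left
        apply Complex.ext <;> simp [hre, h2]
      · right
        apply Complex.ext <;> simp [hre, h2]
  · left
    change |z.im| < m * |z.re| + height
    have : 0 < |z.re| := abs_pos.mpr hre
    nlinarith

end Separatrix

/-! ### Assembly: continuation, singularities and zeros -/

open Separatrix in
theorem corollary2p4 (σ : ℝ → ℝ × ℝ) (hσ : Separatrix.IsSeparatrix σ) :
    ∃ β : ℝ, 0 < β ∧ β < Real.pi / 2 ∧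
      ∃ F : ℂ → ℂ × ℂ,
        AnalyticOnNhd ℂ F (Separatrix.bowTie Separatrix.height β) ∧
        (∀ t : ℝ, F (t : ℂ) = (((σ t).1 : ℂ), ((σ t).2 : ℂ))) ∧
        Separatrix.boundarySingularities F (Separatrix.bowTie Separatrix.height β) =
          {(Separatrix.height : ℂ) * Complex.I, -((Separatrix.height : ℂ) * Complex.I)} ∧
        Separatrix.closureZeros (fun t => (F t).2)
          (Separatrix.bowTie Separatrix.height β) = {0} := by
  obtain ⟨m, hm, S, hS, huniq, hd⟩ := exists_inverse_time
  have hk : 0 < m / 2 := by positivity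
  have htan : Real.tan (Real.arctan (m / 2)) = m / 2 := Real.tan_arctan _
  -- Half the available slope leaves room for continuation across every boundary point except the
  -- corners.
  refine ⟨Real.arctan (m / 2), Real.arctan_pos.mpr hk, Real.arctan_lt_pi_div_two _,
    fun t => (angle (S t), momentum (S t)), ?_⟩
  rw [bowTie_eq (by rw [htan]; exact hk.le), htan]
  set D := slopedBowTie (m / 2) with hD
  have hDm : D ⊆ slopedBowTie m := by
    intro t ht
    have h : |t.im| < m / 2 * |t.re| + height := ht
    change |t.im| < m * |t.re| + height
    nlinarith [abs_nonneg t.re]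
  have hDopen : IsOpen D := isOpen_slopedBowTie _
  have hana : ∀ t ∈ slopedBowTie m, AnalyticAt ℂ (fun t => (angle (S t), momentum (S t))) t := by
    intro t ht
    have hdiff : DifferentiableOn ℂ (fun t => (angle (S t), momentum (S t))) (slopedBowTie m) :=
      DifferentiableOn.prodMk
        (fun w hw => (hasDerivAt_angle_comp hS hd hw).differentiableAt.differentiableWithinAt)
        (differentiableOn_momentum_comp hS hd)
    exact hdiff.analyticAt ((isOpen_slopedBowTie m).mem_nhds ht)
  have hpath := fun e => exists_path (e := e) hDm huniq
  have hnotD : ∀ e : ℂ, e = height * Complex.I ∨ e = -(height * Complex.I) → e ∉ D := by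
    intro e he h
    have h1 : |e.im| < m / 2 * |e.re| + height := h
    rcases he with rfl | rfl <;> simp [abs_of_pos height_pos] at h1
  have hclos : ∀ e : ℂ, e = height * Complex.I ∨ e = -(height * Complex.I) → e ∈ closure D := by
    intro e he
    obtain ⟨γ, h1, -⟩ := hpath e he
    rw [mem_closure_iff_nhdsWithin_neBot]
    exact h1.neBot
  refine ⟨fun t ht => hana t (hDm ht), eq_of_isSeparatrix hσ hm.le hS huniq hd, ?_, ?_⟩
  · ext z
    simp only [Set.mem_insert_iff, Set.mem_singleton_iff]
    constructor
    · rintro ⟨h1, h2⟩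
      refine (closure_slopedBowTie_subset (by linarith : m / 2 < m)
        (frontier_subset_closure h1)).resolve_left fun h3 => h2 ?_
      exact ⟨_, hana z h3, Eventually.of_forall fun _ => rfl⟩
    · intro he
      refine ⟨by rw [hDopen.frontier_eq]; exact ⟨hclos z he, hnotD z he⟩, ?_⟩
      rintro ⟨g, hg, hgF⟩
      obtain ⟨γ, h1, h2⟩ := hpath z he
      -- A continuation would keep the squared momentum bounded along the path, on which it tends to
      -- infinity.
      have h3 : Tendsto (fun y => ‖(g (γ y)).2 ^ 2‖) (𝓝[<] (Real.pi / 2)) (𝓝 ‖(g z).2 ^ 2‖) := by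
        have hc : ContinuousAt (fun t => ‖(g t).2 ^ 2‖) z :=
          ((continuousAt_snd.comp hg.continuousAt).pow 2).norm
        exact hc.tendsto.comp (h1.mono_right nhdsWithin_le_nhds)
      refine not_tendsto_nhds_of_tendsto_atTop h2 _ (h3.congr' ?_)
      filter_upwards [h1.eventually hgF] with y hy
      rw [hy]
  · ext z
    rw [Set.mem_singleton_iff]
    constructor
    · rintro ⟨h1, h2⟩
      rcases closure_slopedBowTie_subset (by linarith : m / 2 < m) h1 with h3 | he
      · have hc : Tendsto (fun t => momentum (S t)) (𝓝[D] z) (𝓝 (momentum (S z))) := by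
          have := (continuousAt_snd.comp (hana z h3).continuousAt)
          exact this.tendsto.mono_left nhdsWithin_le_nhds
        have : (𝓝[D] z).NeBot := mem_closure_iff_nhdsWithin_neBot.mp h1
        have h4 := eq_zero_of_momentum_eq_zero (hS z h3).1 (tendsto_nhds_unique hc h2)
        have h5 := (hS z h3).2
        rw [h4, time_zero] at h5
        exact h5.symm
      · obtain ⟨γ, h3, h4⟩ := hpath z he
        have h5 := ((h2.comp h3).pow 2).norm
        exact absurd h5 (not_tendsto_nhds_of_tendsto_atTop h4 _)
    · rintro rfl
      have h0 : (0 : ℂ) ∈ D := zero_mem_slopedBowTie _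
      refine ⟨subset_closure h0, ?_⟩
      have := (continuousAt_snd.comp (hana 0 (hDm h0)).continuousAt).tendsto
      simp only [Function.comp, inverse_zero huniq, momentum_zero] at this
      exact this.mono_left nhdsWithin_le_nhds
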